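/- Let $M$ be a (finite-dimensional) complex manifold and $TM=T^{1,0}M$ its holomorphic tangent bundle. A CV-structure on $TM$ is a tuple $(TM,C,\mathcal U,g,\kappa,h,D,\mathcal Q)$ where: - $C\in\Omega^1_M\otimes \mathrm{End}(TM)$ (the Higgs field), $\mathcal U\in \mathrm{End}(TM)$ and the non-degenerate symmetric complex bilinear form $g$ are holomorphic, $[C_X,C_Y]=0$, $[C_X,\mathcal U]=0$, and all $C_X$ and $\mathcal U$ are $g$-symmetric; - $\kappa$ is a smooth fibrewise antilinear involution of $TM$ with $g(\kappa a,\kappa b)=\overline{g(a,b)}$; - $h=g(\cdot,\kappa\,\cdot)$ is a non-degenerate hermitian form (possibly with signature) with Chern connection $D$, and $D\kappa=0$, $D_X(C_Y)-D_Y(C_X)-C_{[X,Y]}=0$, $R^D(X,\overline Y)=-[C_X,\kappa C_Y\kappa]$ for holomorphic vector fields $X,Y$; - $\mathcal Q$ is a smooth endomorphism of $TM$ which is $g$-skew-symmetric and $h$-selfadjoint, with $D_X(\mathcal U)-[C_X,\mathcal Q]+C_X=0$ and $D_X(\mathcal Q)+[C_X,\kappa\,\mathcal U\kappa]=0$ for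 $X\in T^{1,0}M$. It satisfies the unfolding condition if there is a holomorphic section $\zeta$ of $TM$ such that $X\mapsto -C_X\zeta$ is an isomorphism $TM\to TM$. Let $(TM,C,\mathcal U,g,\kappa,h,D,\mathcal Q)$ be a CV-structure on $TM$ with the unfolding condition, whose Higgs field is (minus) a commutative multiplication on $TM$, i.e. $C_X=-X\circ$ with $X\circ Y=Y\circ X$. Below, Lie derivatives act on tensors on $M$, and $A^{skew}$ is the $g$-skew-symmetric part of $A$. (a) There are unique holomorphic vector fields $e,E$ with $C_e=-\mathrm{id}$, $C_E=-\mathcal U$, and $(M,\circ,e,E)$ is an F-manifold with Euler field: $\circ$ is holomorphic, commutative and associative with unit $e$, $L_{X\circ Y}(\circ)=X\circ L_Y(\circ)+Y\circ L_X(\circ)$ for holomorphic $X,Y$, and $L_E(\circ)=\circ$. (b) $\mathcal Q=(D_E-L_E)^{skew}$ and $L_{\overline e}(\mathcal Q)=D_{\overline e}(\mathcal Q)=D_e(\mathcal Q)=0$. (c) The following are equivalent: $D_e-L_e=0$ on $C^\infty$ tensors; $D_ee=0$; $L_e(h)=0$; $L_{\overline e}(h)=0$; $L_e(\kappa)=0$;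 $L_{\overline e}(\kappa)=0$; $L_e(g)=0$. If they hold, then also $L_e(\mathcal Q)=0$. (d) Let $d\in\mathbb R$. If $L_E(g)=(2-d)g$, then $$\mathcal Q=D_E-L_E-\tfrac{2-d}{2}\,\mathrm{id},\qquad L_{E-\overline E}(h)=0,$$ $$L_E(\mathcal Q)=L_{\overline E}(\mathcal Q)=D_E(\mathcal Q)=D_{\overline E}(\mathcal Q)=[\mathcal U,\kappa\,\mathcal U\kappa].$$ In particular $L_{E-\overline E}(\mathcal Q)=0$, and $h$ and $\mathcal Q$ are invariant under the flow of $E-\overline E$, i.e. under every local flow of the real vector field corresponding to $i(E-\overline E)$. -/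

import Mathlib

open scoped Manifold ContDiff Topology

noncomputable section

/-- The `C^∞` (indeed real analytic) manifold underlying a complex manifold. -/
instance realIsManifold {V : Type*} [NormedAddCommGroup V] [NormedSpace ℂ V]
    {M : Type*} [TopologicalSpace M] [ChartedSpace V M] [IsManifold 𝓘(ℂ, V) ω M] :
    IsManifold 𝓘(ℝ, V) ω M := by
  refine isManifold_of_contDiffOn 𝓘(ℝ, V) ω M ?_
  intro e e' he he'
  have h := (contDiffGroupoid ω 𝓘(ℂ, V)).compatible he he'
  rw [contDiffGroupoid, mem_groupoid_of_pregroupoid] at h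
  have h1 := h.1
  simp only [contDiffPregroupoid] at h1
  exact h1.restrict_scalars ℝ

namespace CVGeom

/-! ### Vector fields

`M` is a complex manifold modelled on `V`.  The complex vector space `TangentSpace 𝓘(ℂ, V) x` is
the holomorphic tangent space `T^{1,0}_x M`; as a real vector space it is the real tangent space
`TangentSpace 𝓘(ℝ, V) x`, a real vector `v` corresponding to its `(1,0)`-part `(v - i Jv)/2`, where
`J` is multiplication by `i`.  Its conjugate is the `(0,1)`-vector `(v + i Jv)/2`. -/

section VectorFields

variable (V : Type*) [NormedAddCommGroup V] [NormedSpace ℂ V]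
  (M : Type*) [TopologicalSpace M] [ChartedSpace V M]

/-- Vector fields of type `(1,0)` on `M`, without any regularity. -/
abbrev VField : Type _ := (x : M) → TangentSpace 𝓘(ℂ, V) x

/-- Fields of complex endomorphisms of `T^{1,0}M`, without any regularity. -/
abbrev EndoField : Type _ :=
  (x : M) → TangentSpace 𝓘(ℂ, V) x →ₗ[ℂ] TangentSpace 𝓘(ℂ, V) x

/-- Fields of antilinear endomorphisms of `T^{1,0}M`. -/
abbrev ConjField : Type _ :=
  (x : M) → TangentSpace 𝓘(ℂ, V) x →ₛₗ[starRingEnd ℂ] TangentSpace 𝓘(ℂ, V) x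

/-- Fields of complex bilinear forms on `T^{1,0}M`. -/
abbrev BilinField : Type _ :=
  (x : M) → TangentSpace 𝓘(ℂ, V) x →ₗ[ℂ] TangentSpace 𝓘(ℂ, V) x →ₗ[ℂ] ℂ

/-- Fields of sesquilinear forms on `T^{1,0}M`: linear in the first argument, antilinear in the
second. -/
abbrev SesqField : Type _ :=
  (x : M) → TangentSpace 𝓘(ℂ, V) x →ₗ[ℂ] TangentSpace 𝓘(ℂ, V) x →ₛₗ[starRingEnd ℂ] ℂ

/-- Fields of bilinear products `T^{1,0}M × T^{1,0}M → T^{1,0}M`. -/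
abbrev ProdField : Type _ :=
  (x : M) → TangentSpace 𝓘(ℂ, V) x →ₗ[ℂ]
    TangentSpace 𝓘(ℂ, V) x →ₗ[ℂ] TangentSpace 𝓘(ℂ, V) x

variable {V M}

/-- The vector field `A Y`. -/
def EndoField.app (A : EndoField V M) (Y : VField V M) : VField V M := fun x => A x (Y x)

/-- The vector field `κ Y`. -/
def ConjField.app (κ : ConjField V M) (Y : VField V M) : VField V M := fun x => κ x (Y x)

/-- The function `g(Y, Z)`. -/
def BilinField.app (g : BilinField V M) (Y Z : VField V M) : M → ℂ := fun x => g x (Y x) (Z x)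

/-- The function `h(Y, Z)`. -/
def SesqField.app (h : SesqField V M) (Y Z : VField V M) : M → ℂ := fun x => h x (Y x) (Z x)

/-- The vector field `X ∘ Y`. -/
def ProdField.app (m : ProdField V M) (X Y : VField V M) : VField V M := fun x => m x (X x) (Y x)

/-- The endomorphism field `Y ↦ X ∘ Y`. -/
def ProdField.left (m : ProdField V M) (X : VField V M) : EndoField V M := fun x => m x (X x)

/-- The commutator of two endomorphism fields. -/
def comm (A B : EndoField V M) : EndoField V M := fun x => A x ∘ₗ B x - B x ∘ₗ A x

/-- The endomorphism field `κ A κ`. -/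
def conjBy (κ : ConjField V M) (A : EndoField V M) : EndoField V M :=
  fun x => (κ x).comp ((A x).comp (κ x))

/-- `X` is a holomorphic vector field on `U` (used for open `U`). -/
def HolOn [IsManifold 𝓘(ℂ, V) ω M] (X : VField V M) (U : Set M) : Prop :=
  ContMDiffOn 𝓘(ℂ, V) 𝓘(ℂ, V).tangent ω
    (fun x => (⟨x, X x⟩ : TangentBundle 𝓘(ℂ, V) M)) U

/-- `X` is a `C^∞` vector field of type `(1,0)` on `U` (used for open `U`). -/
def SmoothOn [IsManifold 𝓘(ℂ, V) ω M] (X : VField V M) (U : Set M) : Prop :=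
  ContMDiffOn 𝓘(ℝ, V) 𝓘(ℝ, V).tangent ∞
    (fun x => (⟨x, X x⟩ : TangentBundle 𝓘(ℝ, V) M)) U

/-- `f` is a holomorphic function on `U` (used for open `U`). -/
def HolFunOn (f : M → ℂ) (U : Set M) : Prop := ContMDiffOn 𝓘(ℂ, V) 𝓘(ℂ, ℂ) ω f U

/-- `f` is a complex valued `C^∞` function on `U` (used for open `U`). -/
def SmoothFunOn (f : M → ℂ) (U : Set M) : Prop := ContMDiffOn 𝓘(ℝ, V) 𝓘(ℝ, ℂ) ∞ f U

/-- The derivative of a complex valued function along a real vector field. -/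
def realDer (X : VField V M) (f : M → ℂ) : M → ℂ := fun x => mvfderiv 𝓘(ℝ, V) f x (X x)

/-- The Lie bracket of the holomorphic vector fields `X`, `Y`. -/
def holBracket (X Y : VField V M) : VField V M :=
  fun x => VectorField.mlieBracket 𝓘(ℂ, V) X Y x

/-- The Lie bracket of the real vector fields `X`, `Y`, that is, the Lie derivative `L_X Y`. -/
def realLie (X Y : VField V M) : VField V M :=
  fun x => VectorField.mlieBracket 𝓘(ℝ, V) X Y x

/-! ### Derivations in complex directions -/

/-- The action of a derivation in a complex direction `W` (a covariant derivative `D_W` or a Lie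
derivative `L_W`) on functions and on `(1,0)`-fields, together with the action on `(1,0)`-fields of
the derivation in the conjugate direction. -/
structure DirDer (V : Type*) [NormedAddCommGroup V] [NormedSpace ℂ V]
    (M : Type*) [TopologicalSpace M] [ChartedSpace V M] where
  /-- Action of the derivation along `W` on functions. -/
  fn : (M → ℂ) → M → ℂ
  /-- Action of the derivation along `W` on `(1,0)`-fields. -/
  vf : VField V M → VField V M
  /-- Action of the derivation along the conjugate of `W` on `(1,0)`-fields. -/
  vfBar : VField V M → VField V M

/-- `δ_{(X - iJX)/2} Y`, the derivative along the `(1,0)`-field `X`, where `δ` gives the derivatives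
along real vector fields. For `δ = realLie` this is used for holomorphic `X` and is then the
bracket of complex vector fields. -/
def holPart (δ : VField V M → VField V M → VField V M) (X Y : VField V M) : VField V M :=
  fun x => (1 / 2 : ℂ) • (δ X Y x - Complex.I • δ (Complex.I • X) Y x)

/-- `δ_{(X + iJX)/2} Y`, the derivative along the conjugate of the `(1,0)`-field `X`. For
`δ = realLie` this is used for holomorphic `X`. -/
def antiPart (δ : VField V M → VField V M → VField V M) (X Y : VField V M) : VField V M :=
  fun x => (1 / 2 : ℂ) • (δ X Y x + Complex.I • δ (Complex.I • X) Y x)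

/-- The derivation `δ_X` for the `(1,0)`-field `X`. -/
def along (δ : VField V M → VField V M → VField V M) (X : VField V M) : DirDer V M where
  fn f := fun x => (1 / 2 : ℂ) * (realDer X f x - Complex.I * realDer (Complex.I • X) f x)
  vf := holPart δ X
  vfBar := antiPart δ X

/-- The derivation `δ_{X̄}` for the conjugate of the `(1,0)`-field `X`. -/
def alongBar (δ : VField V M → VField V M → VField V M) (X : VField V M) : DirDer V M where
  fn f := fun x => (1 / 2 : ℂ) * (realDer X f x + Complex.I * realDer (Complex.I • X) f x)
  vf := antiPart δ X
  vfBar := holPart δ X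

/-- The difference of two derivations: `δ_{W₁} - δ_{W₂} = δ_{W₁ - W₂}`. -/
def DirDer.sub (a b : DirDer V M) : DirDer V M where
  fn f := a.fn f - b.fn f
  vf Y := a.vf Y - b.vf Y
  vfBar Y := a.vfBar Y - b.vfBar Y

section Tensors

variable [IsManifold 𝓘(ℂ, V) ω M]

/-- `δ(A) = B` for endomorphism fields `A`, `B`, where `δ(A)(Y) = δ(A Y) - A (δ Y)`. -/
def DirDer.EndoEq (δ : DirDer V M) (A B : EndoField V M) : Prop :=
  ∀ (U : Set M), IsOpen U → ∀ Y : VField V M, SmoothOn Y U → ∀ x ∈ U,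
    δ.vf (A.app Y) x - A x (δ.vf Y x) = B x (Y x)

/-- `δ(κ) = 0` for an antilinear endomorphism field `κ`, where
`δ_W(κ)(Y) = δ_W(κ Y) - κ (δ_{W̄} Y)`. -/
def DirDer.ConjZero (δ : DirDer V M) (κ : ConjField V M) : Prop :=
  ∀ (U : Set M), IsOpen U → ∀ Y : VField V M, SmoothOn Y U → ∀ x ∈ U,
    δ.vf (κ.app Y) x - κ x (δ.vfBar Y x) = 0

/-- `δ(g) = c g` for a bilinear form `g` and a constant `c`, where
`δ(g)(Y, Z) = δ(g(Y, Z)) - g(δ Y, Z) - g(Y, δ Z)`. -/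
def DirDer.BilinEq (δ : DirDer V M) (g : BilinField V M) (c : ℂ) : Prop :=
  ∀ (U : Set M), IsOpen U → ∀ Y Z : VField V M, SmoothOn Y U → SmoothOn Z U → ∀ x ∈ U,
    δ.fn (g.app Y Z) x - g x (δ.vf Y x) (Z x) - g x (Y x) (δ.vf Z x) = c * g x (Y x) (Z x)

/-- `δ(h) = 0` for a sesquilinear form `h`, where
`δ_W(h)(Y, Z) = δ_W(h(Y, Z)) - h(δ_W Y, Z) - h(Y, δ_{W̄} Z)`. -/
def DirDer.SesqZero (δ : DirDer V M) (h : SesqField V M) : Prop :=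
  ∀ (U : Set M), IsOpen U → ∀ Y Z : VField V M, SmoothOn Y U → SmoothOn Z U → ∀ x ∈ U,
    δ.fn (h.app Y Z) x - h x (δ.vf Y x) (Z x) - h x (Y x) (δ.vfBar Z x) = 0

end Tensors

/-! ### General tensor fields

A complex tensor of order `(k, l)`, that is, an element of
`(T^*_ℂ M)^{⊗ k} ⊗ (T_ℂ M)^{⊗ l}` with `T_ℂ M = T^{1,0}M ⊕ T^{0,1}M`, is a real multilinear map
from `k` real tangent vectors and `l` real covectors to `ℂ`. -/

/-- Fields of real covectors. -/
abbrev CovField (V : Type*) [NormedAddCommGroup V] [NormedSpace ℂ V]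
    (M : Type*) [TopologicalSpace M] [ChartedSpace V M] : Type _ :=
  (x : M) → TangentSpace 𝓘(ℂ, V) x →ₗ[ℝ] ℝ

/-- Fields of complex tensors of order `(k, l)`. -/
abbrev TensorField (V : Type*) [NormedAddCommGroup V] [NormedSpace ℂ V]
    (M : Type*) [TopologicalSpace M] [ChartedSpace V M] (k l : ℕ) : Type _ :=
  (x : M) → MultilinearMap ℝ (fun _ : Fin k => TangentSpace 𝓘(ℂ, V) x)
    (MultilinearMap ℝ (fun _ : Fin l => TangentSpace 𝓘(ℂ, V) x →ₗ[ℝ] ℝ) ℂ)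

/-- The function `T(Y₁, …, Y_k, α₁, …, α_l)`. -/
def TensorField.app {k l : ℕ} (T : TensorField V M k l) (Y : Fin k → VField V M)
    (α : Fin l → CovField V M) : M → ℂ := fun x => T x (fun i => Y i x) (fun j => α j x)

section GeneralTensors

variable [IsManifold 𝓘(ℂ, V) ω M]

/-- `α` is a `C^∞` covector field on the open set `U`. -/
def CovSmoothOn (α : CovField V M) (U : Set M) : Prop :=
  ∀ U' ⊆ U, IsOpen U' → ∀ Y : VField V M, SmoothOn Y U' →
    SmoothFunOn (V := V) (fun x => (α x (Y x) : ℂ)) U'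

/-- `T` is a `C^∞` tensor field on the open set `U`. -/
def TensorField.IsSmoothOn {k l : ℕ} (T : TensorField V M k l) (U : Set M) : Prop :=
  ∀ U' ⊆ U, IsOpen U' → ∀ (Y : Fin k → VField V M) (α : Fin l → CovField V M),
    (∀ i, SmoothOn (Y i) U') → (∀ j, CovSmoothOn (α j) U') → SmoothFunOn (V := V) (T.app Y α) U'

/-- A local extension of a tangent vector to a `C^∞` vector field near its base point. -/
def localExt {x : M} (v : TangentSpace 𝓘(ℂ, V) x) : VField V M :=
  FiberBundle.extend (E := fun y : M => TangentSpace 𝓘(ℝ, V) y) V (x := x) v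

/-- The derivative `(δ_X α)(v) = X(α(Y)) - α(δ_X Y)` at `x` of a covector field along a real vector
field, where `Y` extends `v`. -/
def covDerFun (δ : VField V M → VField V M → VField V M) (X : VField V M) (α : CovField V M)
    (x : M) (v : TangentSpace 𝓘(ℂ, V) x) : ℝ :=
  mvfderiv 𝓘(ℝ, V) (fun y => α y (localExt v y)) x (X x) - α x (δ X (localExt v) x)

open Classical in
/-- The derivative `δ_X α` of a covector field along a real vector field, as a covector field
(for `C^∞` covector fields `covDerFun` is linear in `v`). -/
def covDer (δ : VField V M → VField V M → VField V M) (X : VField V M) (α : CovField V M) :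
    CovField V M :=
  fun x => if hl : IsLinearMap ℝ (covDerFun δ X α x) then hl.mk' _ else 0

/-- The derivative of a tensor field along a real vector field by the Leibniz rule:
`(δ_X T)(Y₁, …, α_l) = X(T(Y₁, …, α_l)) - ∑ᵢ T(…, δ_X Yᵢ, …) - ∑ⱼ T(…, δ_X αⱼ, …)`. -/
def tensorDer (δ : VField V M → VField V M → VField V M) (X : VField V M) {k l : ℕ}
    (T : TensorField V M k l) (Y : Fin k → VField V M) (α : Fin l → CovField V M) : M → ℂ :=
  fun x => realDer X (T.app Y α) x
    - ∑ i, T.app (Function.update Y i (δ X (Y i))) α x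
    - ∑ j, T.app Y (Function.update α j (covDer δ X (α j))) x

/-- The derivative of a tensor field along the `(1,0)`-field `X`, that is `(δ_X - i δ_{JX})/2`. -/
def tensorHolPart (δ : VField V M → VField V M → VField V M) (X : VField V M) {k l : ℕ}
    (T : TensorField V M k l) (Y : Fin k → VField V M) (α : Fin l → CovField V M) : M → ℂ :=
  fun x => (1 / 2 : ℂ) *
    (tensorDer δ X T Y α x - Complex.I * tensorDer δ (Complex.I • X) T Y α x)

/-- `δ_X = δ'_X` on all `C^∞` tensor fields, for the `(1,0)`-field `X`. -/
def AgreeOnTensors (δ δ' : VField V M → VField V M → VField V M) (X : VField V M) : Prop :=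
  ∀ (k l : ℕ) (U : Set M), IsOpen U → ∀ T : TensorField V M k l, T.IsSmoothOn U →
    ∀ (Y : Fin k → VField V M) (α : Fin l → CovField V M),
      (∀ i, SmoothOn (Y i) U) → (∀ j, CovSmoothOn (α j) U) →
      ∀ x ∈ U, tensorHolPart δ X T Y α x = tensorHolPart δ' X T Y α x

/-- `δ_X = δ'_X` on all `C^∞` vector fields of type `(1,0)`, for the `(1,0)`-field `X`. -/
def AgreeOnFields (δ δ' : VField V M → VField V M → VField V M) (X : VField V M) : Prop :=
  ∀ U : Set M, IsOpen U → ∀ Y : VField V M, SmoothOn Y U →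
    ∀ x ∈ U, holPart δ X Y x = holPart δ' X Y x

end GeneralTensors

/-! ### F-manifolds -/

section FManifold

variable [IsManifold 𝓘(ℂ, V) ω M]

/-- `L_X(∘)(Y, Z) = [X, Y ∘ Z] - [X, Y] ∘ Z - Y ∘ [X, Z]` for holomorphic vector fields. -/
def lieMul (m : ProdField V M) (X Y Z : VField V M) : VField V M :=
  holBracket X (m.app Y Z) - m.app (holBracket X Y) Z - m.app Y (holBracket X Z)

/-- `(M, ∘, e, E)` is an F-manifold with unit field `e` and Euler field `E` (of weight `1`). -/
structure IsFManifold (m : ProdField V M) (e Eu : VField V M) : Prop where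
  holo : ∀ U : Set M, IsOpen U → ∀ X Y : VField V M, HolOn X U → HolOn Y U → HolOn (m.app X Y) U
  comm : ∀ (x : M) (u v : TangentSpace 𝓘(ℂ, V) x), m x u v = m x v u
  assoc : ∀ (x : M) (u v w : TangentSpace 𝓘(ℂ, V) x), m x (m x u v) w = m x u (m x v w)
  unit_holo : HolOn e Set.univ
  unit : ∀ (x : M) (u : TangentSpace 𝓘(ℂ, V) x), m x (e x) u = u
  integrable : ∀ U : Set M, IsOpen U → ∀ X Y Z W : VField V M,
    HolOn X U → HolOn Y U → HolOn Z U → HolOn W U → ∀ x ∈ U,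
      lieMul m (m.app X Y) Z W x
        = m x (X x) (lieMul m Y Z W x) + m x (Y x) (lieMul m X Z W x)
  euler_holo : HolOn Eu Set.univ
  euler : ∀ U : Set M, IsOpen U → ∀ Z W : VField V M, HolOn Z U → HolOn W U → ∀ x ∈ U,
    lieMul m Eu Z W x = m x (Z x) (W x)

end FManifold

/-! ### CV-structures on the tangent bundle -/

section CV

variable [IsManifold 𝓘(ℂ, V) ω M]

variable (V M) in
/-- Connections on the real vector bundle underlying `T^{1,0}M`. -/
abbrev Connection : Type _ :=
  CovariantDerivative 𝓘(ℝ, V) V (fun x : M => TangentSpace 𝓘(ℝ, V) x)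

/-- The covariant derivative `D_X Y` along a real vector field `X`. -/
def covOf (D : Connection V M) (X Y : VField V M) : VField V M := fun x => D Y x (X x)

/-- `D` is the Chern connection of the hermitian form `h`: a `C^∞` complex connection which
is compatible with `h` and whose `(0,1)`-part is the `∂̄`-operator of the holomorphic bundle. -/
structure IsChern (h : SesqField V M) (D : Connection V M) : Prop where
  smooth : ∀ U : Set M, IsOpen U → ∀ X Y : VField V M, SmoothOn X U → SmoothOn Y U →
    SmoothOn (covOf D X Y) U
  complex : ∀ U : Set M, IsOpen U → ∀ X Y : VField V M, SmoothOn Y U → ∀ x ∈ U,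
    covOf D X (Complex.I • Y) x = Complex.I • covOf D X Y x
  metric : ∀ U : Set M, IsOpen U → ∀ X Y Z : VField V M, SmoothOn Y U → SmoothOn Z U → ∀ x ∈ U,
    realDer X (h.app Y Z) x = h x (covOf D X Y x) (Z x) + h x (Y x) (covOf D X Z x)
  dbar : ∀ U : Set M, IsOpen U → ∀ X Y : VField V M, HolOn Y U → ∀ x ∈ U,
    antiPart (covOf D) X Y x = 0

variable (V M) in
/-- A CV-structure `(TM, C, 𝒰, g, κ, h, D, 𝒬)` on the holomorphic tangent bundle of `M`. -/
structure CVStructure where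
  /-- The Higgs field: `C x X` is the endomorphism `C_X` of `T_x M`. -/
  C : ProdField V M
  /-- The holomorphic endomorphism `𝒰`. -/
  U : EndoField V M
  /-- The holomorphic metric. -/
  g : BilinField V M
  /-- The real structure. -/
  κ : ConjField V M
  /-- The hermitian metric. -/
  h : SesqField V M
  /-- The Chern connection of `h`. -/
  D : Connection V M
  /-- The endomorphism `𝒬`. -/
  Q : EndoField V M
  C_holo : ∀ N : Set M, IsOpen N → ∀ X Y : VField V M, HolOn X N → HolOn Y N → HolOn (C.app X Y) N
  U_holo : ∀ N : Set M, IsOpen N → ∀ Y : VField V M, HolOn Y N → HolOn (U.app Y) N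
  g_holo : ∀ N : Set M, IsOpen N → ∀ Y Z : VField V M, HolOn Y N → HolOn Z N →
    HolFunOn (V := V) (g.app Y Z) N
  g_symm : ∀ (x : M) (a b : TangentSpace 𝓘(ℂ, V) x), g x a b = g x b a
  g_nondeg : ∀ x : M, (g x).Nondegenerate
  /-- `C ∧ C = 0`. -/
  C_comm : ∀ (x : M) (u v a : TangentSpace 𝓘(ℂ, V) x), C x u (C x v a) = C x v (C x u a)
  /-- `[C, 𝒰] = 0`. -/
  C_U_comm : ∀ (x : M) (u a : TangentSpace 𝓘(ℂ, V) x), C x u (U x a) = U x (C x u a)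
  C_g : ∀ (x : M) (u a b : TangentSpace 𝓘(ℂ, V) x), g x (C x u a) b = g x a (C x u b)
  U_g : ∀ (x : M) (a b : TangentSpace 𝓘(ℂ, V) x), g x (U x a) b = g x a (U x b)
  κ_smooth : ∀ N : Set M, IsOpen N → ∀ Y : VField V M, SmoothOn Y N → SmoothOn (κ.app Y) N
  κ_sq : ∀ (x : M) (a : TangentSpace 𝓘(ℂ, V) x), κ x (κ x a) = a
  κ_g : ∀ (x : M) (a b : TangentSpace 𝓘(ℂ, V) x),
    g x (κ x a) (κ x b) = (starRingEnd ℂ) (g x a b)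
  h_eq : ∀ (x : M) (a b : TangentSpace 𝓘(ℂ, V) x), h x a b = g x a (κ x b)
  h_herm : ∀ (x : M) (a b : TangentSpace 𝓘(ℂ, V) x), h x b a = (starRingEnd ℂ) (h x a b)
  h_nondeg : ∀ x : M, (h x).Nondegenerate
  chern : IsChern h D
  /-- `D(κ) = 0`. -/
  D_κ : ∀ N : Set M, IsOpen N → ∀ X Y : VField V M, SmoothOn Y N → ∀ x ∈ N,
    covOf D X (κ.app Y) x = κ x (covOf D X Y x)
  /-- `D^{(1,0)}(C) = 0`, that is, `D_X(C_Y) - D_Y(C_X) - C_{[X,Y]} = 0` for holomorphic `X, Y`. -/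
  D_C : ∀ N : Set M, IsOpen N → ∀ X Y Z : VField V M, HolOn X N → HolOn Y N → SmoothOn Z N →
    ∀ x ∈ N,
      (holPart (covOf D) X (C.app Y Z) x - C x (Y x) (holPart (covOf D) X Z x))
        - (holPart (covOf D) Y (C.app X Z) x - C x (X x) (holPart (covOf D) Y Z x))
        - C x (holBracket X Y x) (Z x) = 0
  /-- `D^{(1,0)} D^{(0,1)} + D^{(0,1)} D^{(1,0)} = -(C κ C κ + κ C κ C)`, evaluated on `(X, Ȳ)` with
  `X, Y` holomorphic: `D_X D_Ȳ - D_Ȳ D_X = -[C_X, κ C_Y κ]`. -/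
  D_curv : ∀ N : Set M, IsOpen N → ∀ X Y Z : VField V M, HolOn X N → HolOn Y N → SmoothOn Z N →
    ∀ x ∈ N,
      holPart (covOf D) X (antiPart (covOf D) Y Z) x
          - antiPart (covOf D) Y (holPart (covOf D) X Z) x
        = -(comm (C.left X) (conjBy κ (C.left Y)) x (Z x))
  Q_smooth : ∀ N : Set M, IsOpen N → ∀ Y : VField V M, SmoothOn Y N → SmoothOn (Q.app Y) N
  Q_g : ∀ (x : M) (a b : TangentSpace 𝓘(ℂ, V) x), g x (Q x a) b = -g x a (Q x b)
  /-- `D^{(1,0)}(𝒰) - [C, 𝒬] + C = 0`. -/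
  D_U : ∀ N : Set M, IsOpen N → ∀ X Y : VField V M, SmoothOn X N → SmoothOn Y N → ∀ x ∈ N,
    (holPart (covOf D) X (U.app Y) x - U x (holPart (covOf D) X Y x))
      - comm (C.left X) Q x (Y x) + C x (X x) (Y x) = 0
  /-- `D^{(1,0)}(𝒬) + [C, κ 𝒰 κ] = 0`. -/
  D_Q : ∀ N : Set M, IsOpen N → ∀ X Y : VField V M, SmoothOn X N → SmoothOn Y N → ∀ x ∈ N,
    (holPart (covOf D) X (Q.app Y) x - Q x (holPart (covOf D) X Y x))
      + comm (C.left X) (conjBy κ U) x (Y x) = 0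
  Q_h : ∀ (x : M) (a b : TangentSpace 𝓘(ℂ, V) x), h x (Q x a) b = h x a (Q x b)

namespace CVStructure

variable (S : CVStructure V M)

/-- The unfolding condition: for some holomorphic section `ζ` of `TM` (a primitive section), the
bundle map `X ↦ -C_X ζ` is an isomorphism. -/
def Unfolding : Prop :=
  ∃ ζ : VField V M, HolOn ζ Set.univ ∧
    ∀ x : M, Function.Bijective (fun X : TangentSpace 𝓘(ℂ, V) x => -(S.C x X (ζ x)))

/-- The product `X ∘ Y = -C_X Y`. -/
def mul : ProdField V M := fun x => -(S.C x)

/-- `e` and `E` are holomorphic vector fields with `C_e = -id` and `C_E = -𝒰`. -/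
def IsUnitEuler (e Eu : VField V M) : Prop :=
  HolOn e Set.univ ∧ HolOn Eu Set.univ ∧
    ∀ (x : M) (Y : TangentSpace 𝓘(ℂ, V) x), S.C x (e x) Y = -Y ∧ S.C x (Eu x) Y = -(S.U x Y)

/-- The covariant derivative of the Chern connection. -/
def cov : VField V M → VField V M → VField V M := covOf S.D

end CVStructure

/-- `B` is the skew-symmetric part of `A` with respect to `g`. -/
def IsSkewPart (g : BilinField V M) (A B : EndoField V M) : Prop :=
  ∀ (x : M) (a b : TangentSpace 𝓘(ℂ, V) x),
    g x (B x a) b = -g x a (B x b) ∧ g x ((A x - B x) a) b = g x a ((A x - B x) b)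

/-- `Q = (δ_X - δ'_X)^{skew}` for a `(1,0)`-field `X`, where `δ_X - δ'_X` is an endomorphism field `A`
of `T^{1,0}M`. -/
def IsSkewPartOfDiff (g : BilinField V M) (δ δ' : VField V M → VField V M → VField V M)
    (X : VField V M) (Q : EndoField V M) : Prop :=
  ∃ A : EndoField V M,
    (∀ U : Set M, IsOpen U → ∀ Y : VField V M, SmoothOn Y U → ∀ x ∈ U,
      holPart δ X Y x - holPart δ' X Y x = A x (Y x)) ∧ IsSkewPart g A Q

/-! ### Flows -/

/-- `φ` is a `C^∞` local flow of the real vector field `Z`, defined on the open set `W` of pairs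
`(t, x)`; for each `x` the set of times is an interval, containing `0` if not empty. -/
structure IsLocalFlow (Z : VField V M) (W : Set (ℝ × M)) (φ : ℝ × M → M) : Prop where
  isOpen : IsOpen W
  ordConnected : ∀ x : M, {t : ℝ | (t, x) ∈ W}.OrdConnected
  zero_mem : ∀ (t : ℝ) (x : M), (t, x) ∈ W → (0, x) ∈ W
  smooth : ContMDiffOn (𝓘(ℝ, ℝ).prod 𝓘(ℝ, V)) 𝓘(ℝ, V) ∞ φ W
  init : ∀ x : M, (0, x) ∈ W → φ (0, x) = x
  curve : ∀ x : M, IsMIntegralCurveOn (I := 𝓘(ℝ, V)) (fun t => φ (t, x)) (fun y => Z y)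
    {t : ℝ | (t, x) ∈ W}

/-- The differential of `φ_t` at `x`. -/
def flowDeriv (φ : ℝ × M → M) (t : ℝ) (x : M) (v : TangentSpace 𝓘(ℂ, V) x) :
    TangentSpace 𝓘(ℂ, V) (φ (t, x)) :=
  mfderiv 𝓘(ℝ, V) 𝓘(ℝ, V) (fun y => φ (t, y)) x v

/-- `φ_t^* h = h` and `φ_t^* Q = Q` for every local flow `φ` of `Z`. -/
def FlowInvariant (Z : VField V M) (h : SesqField V M) (Q : EndoField V M) : Prop :=
  ∀ (W : Set (ℝ × M)) (φ : ℝ × M → M), IsLocalFlow Z W φ →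
    ∀ (t : ℝ) (x : M), (t, x) ∈ W → ∀ v w : TangentSpace 𝓘(ℂ, V) x,
      h (φ (t, x)) (flowDeriv φ t x v) (flowDeriv φ t x w) = h x v w ∧
      flowDeriv φ t x (Q x v) = Q (φ (t, x)) (flowDeriv φ t x v)

end CV

end VectorFields

end CVGeom

/-!
# CV-structures on the tangent bundle with a commutative multiplication

Write `X ∘ Y = -C_X Y`. Commutativity of `∘` together with `[C_X, C_Y] = 0` makes `∘` associative.
A primitive section `ζ` gives the unit field as the solution `e` of `ζ ∘ e = ζ`, which is
holomorphic because the endomorphism `ζ ∘` is holomorphic and invertible, and the Euler field is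
`E = 𝒰 e` (`existsUnique_isUnitEuler`).

The equation `D_X(C_Y) - D_Y(C_X) = C_{[X,Y]}` turns the brackets in `L_X(∘)` into the
endomorphisms `D_Z(X ∘)` (`lieMul_mul`). The integrability condition of F-manifolds is then the
Leibniz rule for `D_Z(X ∘ Y ∘)`, and `L_E(∘) = ∘` is the equation `D_Z(𝒰) = [𝒬, Z ∘] + Z ∘`
(`lieMul_mul_left`, `lieMul_euler`).

The remaining claims rest on one object. For a holomorphic field `X` the difference `A = D_X - L_X`
is a complex linear endomorphism field, and in the direction conjugate to `X` the operators `D` and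
`L` agree, since both are given by `∂̄` there (`IsCovSubLie`, `exists_isCovSubLie`). Hence the Lie
derivatives of `h`, `κ`, `g` are algebraic expressions in `A`, as these tensors are parallel:
`L_X(h) = h(A ·, ·)`, `L_X(κ) = -A κ` and so on.

* The endomorphisms `D_E - L_E - 𝒬` and `D_e - L_e` commute with multiplication
  (`IsCovSubLie.euler_map_mul`, `IsCovSubLie.unit_map_mul`). Such an endomorphism is multiplication
  by its value on `e`, so it is `g`-symmetric. Thus `𝒬` is the skew-symmetric part of `D_E - L_E`.
* All conditions on the unit field say that `D_e - L_e` vanishes (`tfae_unit`); it is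
  multiplication by `D_e e`, and by symmetry `L_e(g) = 2 g((D_e - L_e) ·, ·)`.
* If `L_E(g) = (2 - d) g`, the symmetric part of `D_E - L_E` is `(2 - d) / 2`
  (`IsCovSubLie.euler_eq`). Then `D_E - L_E` commutes with `𝒬` and is `h`-selfadjoint, which gives
  the formulas for `L_E(𝒬)` and `L_{E - Ē}(h) = 0`.

For the flow `φ` of `i (E - Ē)`, the derivative of `s ↦ h(dφ_s v, dφ_s w)` is computed in a chart.
The variational equation for `dφ_s v` and the vanishing of the Lie derivative of `h` show that it
is zero (`IsLocalFlow.hasDerivAt_sesq_flowDeriv`). The same holds for the form `h(𝒬 ·, ·)`, and as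
`h` is nondegenerate, `𝒬` is invariant too.
-/

namespace CVGeom

/-! ### The tangent bundle in charts, over the real and the complex numbers -/

section Charts

section Coordinates

variable {𝕜 : Type*} [NontriviallyNormedField 𝕜] {E : Type*}
    [NormedAddCommGroup E] [NormedSpace 𝕜 E] {N : Type*} [TopologicalSpace N] [ChartedSpace E N]

/-- The vector field `X` in the preferred chart at `p`, as a map `E → E`. It is the pullback along
the inverse chart that enters the definition of `VectorField.mlieBracket`; outside the target of
the chart its values are meaningless. -/
def coordField (𝕜 : Type*) [NontriviallyNormedField 𝕜] {E : Type*}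
    [NormedAddCommGroup E] [NormedSpace 𝕜 E] {N : Type*} [TopologicalSpace N] [ChartedSpace E N]
    (p : N) (X : (x : N) → TangentSpace 𝓘(𝕜, E) x) : E → E := fun y =>
  VectorField.mpullbackWithin 𝓘(𝕜, E) 𝓘(𝕜, E) (extChartAt 𝓘(𝕜, E) p).symm X
    (Set.range 𝓘(𝕜, E)) y

theorem mfderiv_extChartAt_self [IsManifold 𝓘(𝕜, E) 1 N] (x : N) :
    (mfderiv 𝓘(𝕜, E) 𝓘(𝕜, E) (extChartAt 𝓘(𝕜, E) x) x : E →L[𝕜] E) =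
      ContinuousLinearMap.id 𝕜 E := by
  ext v
  exact (congrArg (fun A : E →L[𝕜] E => A v)
    (mfderiv_chartAt_eq_tangentCoordChange (I := 𝓘(𝕜, E)) (mem_chart_source E x))).trans
    (tangentCoordChange_self (mem_extChartAt_source x))

/-- The Lie bracket at `x` computed in the preferred chart at `x`. -/
theorem mlieBracket_eq_coordField [IsManifold 𝓘(𝕜, E) 1 N]
    (X Y : (x : N) → TangentSpace 𝓘(𝕜, E) x) (x : N) :
    (VectorField.mlieBracket 𝓘(𝕜, E) X Y x : E) =
      fderiv 𝕜 (coordField 𝕜 x Y) (extChartAt 𝓘(𝕜, E) x x)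
          (coordField 𝕜 x X (extChartAt 𝓘(𝕜, E) x x))
        - fderiv 𝕜 (coordField 𝕜 x X) (extChartAt 𝓘(𝕜, E) x x)
          (coordField 𝕜 x Y (extChartAt 𝓘(𝕜, E) x x)) := by
  have hs : (extChartAt 𝓘(𝕜, E) x).symm ⁻¹' Set.univ ∩ Set.range 𝓘(𝕜, E) = Set.univ := by simp
  have h1 : (VectorField.mlieBracket 𝓘(𝕜, E) X Y x : E) =
      (mfderiv 𝓘(𝕜, E) 𝓘(𝕜, E) (extChartAt 𝓘(𝕜, E) x) x : E →L[𝕜] E).inverse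
      (VectorField.lieBracketWithin (E := E) 𝕜 (coordField 𝕜 x X) (coordField 𝕜 x Y)
        ((extChartAt 𝓘(𝕜, E) x).symm ⁻¹' Set.univ ∩ Set.range 𝓘(𝕜, E))
        (extChartAt 𝓘(𝕜, E) x x)) := rfl
  have h2 : (mfderiv 𝓘(𝕜, E) 𝓘(𝕜, E) (extChartAt 𝓘(𝕜, E) x) x : E →L[𝕜] E).inverse =
      ContinuousLinearMap.id 𝕜 E :=
    (congrArg ContinuousLinearMap.inverse (mfderiv_extChartAt_self x)).trans
      ContinuousLinearMap.inverse_id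
  rw [hs, VectorField.lieBracketWithin_univ] at h1
  exact h1.trans (congrArg (fun A : E →L[𝕜] E => A _) h2)

theorem differentiableAt_coordField [CompleteSpace E] [IsManifold 𝓘(𝕜, E) 2 N]
    {X : (x : N) → TangentSpace 𝓘(𝕜, E) x} {x : N}
    (hX : MDifferentiableAt 𝓘(𝕜, E) 𝓘(𝕜, E).tangent
      (fun x => (⟨x, X x⟩ : TangentBundle 𝓘(𝕜, E) N)) x) :
    DifferentiableAt 𝕜 (coordField 𝕜 x X) (extChartAt 𝓘(𝕜, E) x x) := by
  have := hX.mdifferentiableWithinAt (s := Set.univ)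
    |>.differentiableWithinAt_mpullbackWithin_vectorField
  have hs : (extChartAt 𝓘(𝕜, E) x).symm ⁻¹' Set.univ ∩ Set.range 𝓘(𝕜, E) = Set.univ := by simp
  rw [hs] at this
  exact differentiableWithinAt_univ.1 this

/-- The trivialization of the tangent bundle at `p` is the derivative of the chart at `p`. -/
theorem trivializationAt_tangent_eq_mfderiv [IsManifold 𝓘(𝕜, E) 1 N] (p : N) {x : N}
    (hx : x ∈ (chartAt E p).source) (v : E) :
    (trivializationAt E (TangentSpace 𝓘(𝕜, E)) p (⟨x, v⟩ : TangentBundle 𝓘(𝕜, E) N)).2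
      = (mfderiv 𝓘(𝕜, E) 𝓘(𝕜, E) (extChartAt 𝓘(𝕜, E) p) x : E →L[𝕜] E) v :=
  (congrArg (fun A : E →L[𝕜] E => A v)
    (mfderiv_chartAt_eq_tangentCoordChange (I := 𝓘(𝕜, E)) hx)).symm

theorem coordField_extChartAt [IsManifold 𝓘(𝕜, E) 1 N] (p : N)
    (X : (x : N) → TangentSpace 𝓘(𝕜, E) x) {x : N} (hx : x ∈ (chartAt E p).source) :
    coordField 𝕜 p X (extChartAt 𝓘(𝕜, E) p x)
      = (mfderiv 𝓘(𝕜, E) 𝓘(𝕜, E) (extChartAt 𝓘(𝕜, E) p) x : E →L[𝕜] E) (X x) := by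
  have hx' : x ∈ (extChartAt 𝓘(𝕜, E) p).source := by rwa [extChartAt_source]
  have h1 := mfderivWithin_extChartAt_symm_comp_mfderiv_extChartAt' hx'
  have h2 := isInvertible_mfderivWithin_extChartAt_symm (I := 𝓘(𝕜, E))
    ((extChartAt 𝓘(𝕜, E) p).map_source hx')
  obtain ⟨e, he⟩ := h2
  have h3 : (mfderiv 𝓘(𝕜, E) 𝓘(𝕜, E) (extChartAt 𝓘(𝕜, E) p) x : E →L[𝕜] E) (X x)
      = e.symm (X x) := by
    have h4 := congrArg (fun A : E →L[𝕜] E => A (X x)) h1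
    have h5 : e ((mfderiv 𝓘(𝕜, E) 𝓘(𝕜, E) (extChartAt 𝓘(𝕜, E) p) x : E →L[𝕜] E) (X x))
      = X x := (congrArg (fun A : E →L[𝕜] E => A
        ((mfderiv 𝓘(𝕜, E) 𝓘(𝕜, E) (extChartAt 𝓘(𝕜, E) p) x : E →L[𝕜] E) (X x))) he).trans h4
    exact (e.symm_apply_eq.2 h5.symm).symm
  rw [h3]
  have h6 : coordField 𝕜 p X (extChartAt 𝓘(𝕜, E) p x)
      = (mfderivWithin 𝓘(𝕜, E) 𝓘(𝕜, E) (extChartAt 𝓘(𝕜, E) p).symm (Set.range 𝓘(𝕜, E))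
        (extChartAt 𝓘(𝕜, E) p x) : E →L[𝕜] E).inverse
        (X ((extChartAt 𝓘(𝕜, E) p).symm (extChartAt 𝓘(𝕜, E) p x))) := rfl
  rw [h6, (extChartAt 𝓘(𝕜, E) p).left_inv hx']
  exact congrArg (fun A : E →L[𝕜] E => A (X x))
    ((congrArg ContinuousLinearMap.inverse he.symm).trans (ContinuousLinearMap.inverse_equiv e))

end Coordinates

variable {V : Type*} [NormedAddCommGroup V] [NormedSpace ℂ V]
  {M : Type*} [TopologicalSpace M] [ChartedSpace V M]

theorem hasMFDerivWithinAt_restrictScalars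
    {V' : Type*} [NormedAddCommGroup V'] [NormedSpace ℂ V']
    {M' : Type*} [TopologicalSpace M'] [ChartedSpace V' M'] {f : M → M'} {s : Set M} {x : M}
    {f' : V →L[ℂ] V'}
    (hf : HasMFDerivWithinAt 𝓘(ℂ, V) 𝓘(ℂ, V') f s x f') :
    HasMFDerivWithinAt 𝓘(ℝ, V) 𝓘(ℝ, V') f s x (f'.restrictScalars ℝ) :=
  ⟨hf.1, hf.2.restrictScalars ℝ⟩

theorem contMDiffAt_restrictScalars
    {V' : Type*} [NormedAddCommGroup V'] [NormedSpace ℂ V']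
    {M' : Type*} [TopologicalSpace M'] [ChartedSpace V' M'] {n : WithTop ℕ∞} {f : M → M'} {x : M}
    (hf : ContMDiffAt 𝓘(ℂ, V) 𝓘(ℂ, V') n f x) :
    ContMDiffAt 𝓘(ℝ, V) 𝓘(ℝ, V') n f x := by
  rw [contMDiffAt_iff] at hf ⊢
  exact ⟨hf.1, hf.2.restrict_scalars ℝ⟩

variable [IsManifold 𝓘(ℂ, V) ω M]

theorem mfderiv_extChartAt_real_eq (p : M) {x : M} (hx : x ∈ (chartAt V p).source) :
    (mfderiv 𝓘(ℝ, V) 𝓘(ℝ, V) (extChartAt 𝓘(ℝ, V) p) x : V →L[ℝ] V)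
      = ContinuousLinearMap.restrictScalars ℝ
        (mfderiv 𝓘(ℂ, V) 𝓘(ℂ, V) (extChartAt 𝓘(ℂ, V) p) x : V →L[ℂ] V) := by
  have hd : MDifferentiableAt 𝓘(ℂ, V) 𝓘(ℂ, V) (extChartAt 𝓘(ℂ, V) p) x :=
    mdifferentiableAt_extChartAt hx
  have h1 := hasMFDerivWithinAt_restrictScalars hd.hasMFDerivAt.hasMFDerivWithinAt (s := Set.univ)
  exact (hasMFDerivWithinAt_univ.1 h1).mfderiv

/-- The complex and the real coordinate expression of a field agree, because the derivative of a
chart is complex linear. -/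
theorem coordField_real_eq (X : VField V M) (p : M) :
    coordField ℝ p X =ᶠ[𝓝 (extChartAt 𝓘(ℂ, V) p p)] coordField ℂ p X := by
  filter_upwards [extChartAt_target_mem_nhds (I := 𝓘(ℂ, V)) p] with y hy
  have hs := (extChartAt 𝓘(ℂ, V) p).map_target hy
  rw [extChartAt_source] at hs
  have h1 := coordField_extChartAt (𝕜 := ℂ) p X hs
  have h2 := coordField_extChartAt (𝕜 := ℝ) (E := V) (N := M) p X hs
  rw [(extChartAt 𝓘(ℂ, V) p).right_inv hy] at h1
  have h3 : extChartAt 𝓘(ℝ, V) p ((extChartAt 𝓘(ℂ, V) p).symm y) = y :=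
    (extChartAt 𝓘(ℂ, V) p).right_inv hy
  rw [h3] at h2
  rw [h1, h2, mfderiv_extChartAt_real_eq p hs]
  rfl

/-- On holomorphic fields the bracket of the underlying real fields is the holomorphic bracket. -/
theorem realLie_eq_holBracket [CompleteSpace V] {X Y : VField V M} {x : M}
    (hX : MDifferentiableAt 𝓘(ℂ, V) 𝓘(ℂ, V).tangent
      (fun x => (⟨x, X x⟩ : TangentBundle 𝓘(ℂ, V) M)) x)
    (hY : MDifferentiableAt 𝓘(ℂ, V) 𝓘(ℂ, V).tangent
      (fun x => (⟨x, Y x⟩ : TangentBundle 𝓘(ℂ, V) M)) x) :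
    realLie X Y x = holBracket X Y x := by
  have kX := (differentiableAt_coordField hX).fderiv_restrictScalars ℝ
  have kY := (differentiableAt_coordField hY).fderiv_restrictScalars ℝ
  have h1 := mlieBracket_eq_coordField (𝕜 := ℂ) X Y x
  have h2 := mlieBracket_eq_coordField (𝕜 := ℝ) (E := V) (N := M) X Y x
  have eX : coordField ℝ x X =ᶠ[𝓝 (extChartAt 𝓘(ℝ, V) x x)] coordField ℂ x X :=
    coordField_real_eq X x
  have eY : coordField ℝ x Y =ᶠ[𝓝 (extChartAt 𝓘(ℝ, V) x x)] coordField ℂ x Y :=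
    coordField_real_eq Y x
  rw [eX.fderiv_eq, eY.fderiv_eq, eX.eq_of_nhds, eY.eq_of_nhds] at h2
  refine h2.trans (Eq.trans ?_ h1.symm)
  exact congrArg₂ (fun A B : V →L[ℝ] V => A _ - B _) kY kX

/-- Near the base point the trivializations of the holomorphic and the real tangent bundle
agree. -/
theorem trivializationAt_real_eq (p : M) {x : M} (hx : x ∈ (chartAt V p).source) (v : V) :
    (trivializationAt V (TangentSpace 𝓘(ℝ, V)) p (⟨x, v⟩ : TangentBundle 𝓘(ℝ, V) M)).2
      = (trivializationAt V (TangentSpace 𝓘(ℂ, V)) p (⟨x, v⟩ : TangentBundle 𝓘(ℂ, V) M)).2 := by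
  rw [trivializationAt_tangent_eq_mfderiv p hx v, trivializationAt_tangent_eq_mfderiv p hx v,
    mfderiv_extChartAt_real_eq p hx]
  rfl

theorem HolOn.smoothOn {X : VField V M} {U : Set M} (hX : HolOn X U) (hU : IsOpen U) :
    SmoothOn X U := by
  intro x hx
  have h1 : ContMDiffAt _ _ _ _ x := (hX x hx).contMDiffAt (hU.mem_nhds hx)
  refine ContMDiffAt.contMDiffWithinAt ?_
  refine (Bundle.contMDiffAt_section (E := fun x : M => TangentSpace 𝓘(ℝ, V) x) (s := X) x).2 ?_
  have h2 := (Bundle.contMDiffAt_section (E := fun x : M => TangentSpace 𝓘(ℂ, V) x) (s := X) x).1 h1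
  have h3 := (contMDiffAt_restrictScalars h2).of_le (m := ∞) le_top
  refine h3.congr_of_eventuallyEq ?_
  filter_upwards [(chartAt V x).open_source.mem_nhds (mem_chart_source V x)] with y hy
  exact trivializationAt_real_eq x hy (X y)

end Charts

/-! ### The difference of a Chern connection and the Lie derivative -/

section ChernSubLie

variable {V : Type*} [NormedAddCommGroup V] [NormedSpace ℂ V]
  {M : Type*} [TopologicalSpace M] [ChartedSpace V M] [IsManifold 𝓘(ℂ, V) ω M]

theorem HolOn.mdifferentiableAt {X : VField V M} {U : Set M} (hX : HolOn X U) (hU : IsOpen U)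
    {x : M} (hx : x ∈ U) : MDifferentiableAt 𝓘(ℂ, V) 𝓘(ℂ, V).tangent
      (fun x => (⟨x, X x⟩ : TangentBundle 𝓘(ℂ, V) M)) x :=
  ((hX x hx).contMDiffAt (hU.mem_nhds hx)).mdifferentiableAt (by simp)

theorem SmoothOn.mdifferentiableAt {X : VField V M} {U : Set M} (hX : SmoothOn X U)
    (hU : IsOpen U) {x : M} (hx : x ∈ U) : MDifferentiableAt 𝓘(ℝ, V) 𝓘(ℝ, V).tangent
      (fun x => (⟨x, X x⟩ : TangentBundle 𝓘(ℝ, V) M)) x :=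
  ((hX x hx).contMDiffAt (hU.mem_nhds hx)).mdifferentiableAt (by simp)

theorem HolOn.mono {X : VField V M} {U U' : Set M} (hX : HolOn X U) (h : U' ⊆ U) : HolOn X U' :=
  ContMDiffOn.mono hX h

theorem SmoothOn.mono {X : VField V M} {U U' : Set M} (hX : SmoothOn X U) (h : U' ⊆ U) :
    SmoothOn X U' :=
  ContMDiffOn.mono hX h

theorem HolOn.const_smul {X : VField V M} {U : Set M} (hX : HolOn X U) (c : ℂ) :
    HolOn (c • X) U :=
  ContMDiffOn.const_smul_section (V := fun x : M => TangentSpace 𝓘(ℂ, V) x) hX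

theorem HolOn.neg {X : VField V M} {U : Set M} (hX : HolOn X U) : HolOn (-X) U :=
  ContMDiffOn.neg_section (V := fun x : M => TangentSpace 𝓘(ℂ, V) x) hX

theorem SmoothOn.neg {X : VField V M} {U : Set M} (hX : SmoothOn X U) : SmoothOn (-X) U :=
  ContMDiffOn.neg_section (V := fun x : M => TangentSpace 𝓘(ℝ, V) x) hX

/-- Every tangent vector is the value of a vector field which is holomorphic near its base
point. -/
theorem exists_holOn_apply_eq (x : M) (v : TangentSpace 𝓘(ℂ, V) x) :
    ∃ (U : Set M) (Y : VField V M), IsOpen U ∧ x ∈ U ∧ HolOn Y U ∧ Y x = v := by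
  obtain ⟨s, hs, hY⟩ := FiberBundle.exists_contMDiffOn_extend (k := ω) 𝓘(ℂ, V) V
    (V := fun y : M => TangentSpace 𝓘(ℂ, V) y) v
  obtain ⟨U, hUs, hU, hx⟩ := mem_nhds_iff.1 hs
  exact ⟨U, _, hU, hx, ContMDiffOn.mono hY hUs, FiberBundle.extend_apply_self V v⟩

theorem holBracket_const_smul_left [CompleteSpace V] (c : ℂ) {X Y : VField V M} {U : Set M}
    (hX : HolOn X U) (hU : IsOpen U) {x : M} (hx : x ∈ U) :
    holBracket (c • X) Y x = c • holBracket X Y x :=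
  VectorField.mlieBracket_const_smul_left (hX.mdifferentiableAt hU hx)

theorem holBracket_const_smul_right [CompleteSpace V] (c : ℂ) {X Y : VField V M} {U : Set M}
    (hY : HolOn Y U) (hU : IsOpen U) {x : M} (hx : x ∈ U) :
    holBracket X (c • Y) x = c • holBracket X Y x :=
  VectorField.mlieBracket_const_smul_right (hY.mdifferentiableAt hU hx)

theorem covOf_real_smul (D : Connection V M) (X : VField V M) {Y : VField V M} {U : Set M}
    (c : ℝ) (hY : SmoothOn Y U) (hU : IsOpen U) {x : M} (hx : x ∈ U) :
    covOf D X (fun y => c • Y y) x = c • covOf D X Y x :=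
  congrArg (fun A : V →L[ℝ] V => A (X x))
    (D.isCovariantDerivativeOnUniv.smul_const c (hY.mdifferentiableAt hU hx) trivial)

theorem covOf_neg (D : Connection V M) (X : VField V M) {Y : VField V M} {U : Set M}
    (hY : SmoothOn Y U) (hU : IsOpen U) {x : M} (hx : x ∈ U) :
    covOf D X (-Y) x = -covOf D X Y x := by
  have h := covOf_real_smul D X (-1) hY hU hx
  have e : (fun y => (-1 : ℝ) • Y y) = -Y := by ext y; simp
  rw [e] at h
  rw [h]; simp

/-- For a real vector field `X` the difference `D_X - L_X` is tensorial. -/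
theorem covOf_sub_realLie [FiniteDimensional ℂ V] (D : Connection V M) {X Y : VField V M}
    {U U' : Set M} (hX : SmoothOn X U') (hU' : IsOpen U') (hY : SmoothOn Y U) (hU : IsOpen U)
    {x : M} (hx : x ∈ U) (hx' : x ∈ U') :
    haveI := FiniteDimensional.complete ℂ V
    covOf D X Y x - realLie X Y x
      = (D.torsion x (X x) (Y x) + D X x (Y x) : V) := by
  have := FiniteDimensional.complete ℂ V
  have h := D.torsion_apply (hX.mdifferentiableAt hU' hx') (hY.mdifferentiableAt hU hx)
  rw [h]
  -- `D_X Y - [X, Y] = (D_X Y - D_Y X - [X, Y]) + D_Y X`, and both terms depend only on `Y x`.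
  have e : ∀ a b c : V, a - c = (a - b - c) + b := fun a b c => by abel
  exact e _ _ _

/-- A real linear map commuting with `i` is complex linear. -/
theorem map_complex_smul {f : V →L[ℝ] V} (hf : ∀ v, f (Complex.I • v) = Complex.I • f v)
    (c : ℂ) (v : V) : f (c • v) = c • f v := by
  have h1 : ∀ w : V, c • w = c.re • w + c.im • Complex.I • w := fun w => by
    conv_lhs => rw [← Complex.re_add_im c]
    rw [add_smul, mul_smul, Complex.coe_smul, Complex.coe_smul]
  rw [h1, f.map_add, f.map_smul, f.map_smul, hf, ← h1]

/-- On holomorphic fields `D_X` is complex linear in `X`, since its `(0,1)`-part vanishes. -/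
theorem covOf_I_smul_of_holOn {h : SesqField V M} {D : Connection V M} (hD : IsChern h D)
    (X : VField V M) {Y : VField V M} {U : Set M} (hY : HolOn Y U) (hU : IsOpen U)
    {x : M} (hx : x ∈ U) :
    covOf D (Complex.I • X) Y x = Complex.I • covOf D X Y x := by
  have h1 := hD.dbar U hU X Y hY x hx
  simp only [antiPart, smul_eq_zero] at h1
  have h2 : covOf D X Y x + Complex.I • covOf D (Complex.I • X) Y x = 0 := by
    simpa using h1
  rw [eq_neg_of_add_eq_zero_left h2, smul_neg, smul_smul]
  simp

/-- For a holomorphic field `X` the difference `D_X - L_X` is a complex linear endomorphism field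
`A`, and `D_{iX} - L_{iX} = i A`. In other words, the difference is `A` on the `(1,0)`-part of `X`
and vanishes on its conjugate. -/
theorem exists_endoField_covOf_sub_realLie [FiniteDimensional ℂ V] {h : SesqField V M}
    {D : Connection V M} (hD : IsChern h D) {X : VField V M} (hX : HolOn X Set.univ) :
    ∃ A : EndoField V M, ∀ U : Set M, IsOpen U → ∀ Y : VField V M, SmoothOn Y U → ∀ x ∈ U,
      covOf D X Y x - realLie X Y x = A x (Y x) ∧
      covOf D (Complex.I • X) Y x - realLie (Complex.I • X) Y x = Complex.I • A x (Y x) := by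
  have := FiniteDimensional.complete ℂ V
  have hIX : HolOn (Complex.I • X) Set.univ := hX.const_smul _
  let f : (x : M) → (V →L[ℝ] V) := fun x => D.torsion x (X x) + D X x
  let f' : (x : M) → (V →L[ℝ] V) := fun x =>
    D.torsion x ((Complex.I • X) x) + D (Complex.I • X) x
  have hf : ∀ U : Set M, IsOpen U → ∀ Y : VField V M, SmoothOn Y U → ∀ x ∈ U,
      covOf D X Y x - realLie X Y x = f x (Y x) := fun U hU Y hY x hx =>
    covOf_sub_realLie D (hX.smoothOn isOpen_univ) isOpen_univ hY hU hx trivial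
  have hf' : ∀ U : Set M, IsOpen U → ∀ Y : VField V M, SmoothOn Y U → ∀ x ∈ U,
      covOf D (Complex.I • X) Y x - realLie (Complex.I • X) Y x = f' x (Y x) :=
    fun U hU Y hY x hx =>
    covOf_sub_realLie D (hIX.smoothOn isOpen_univ) isOpen_univ hY hU hx trivial
  -- Both identities are tensorial in `v`, so they may be checked on holomorphic fields, where `D`
  -- and the Lie derivative are complex linear in both arguments.
  have key : ∀ (x : M) (v : V), f x (Complex.I • v) = Complex.I • f x v ∧
      f' x v = Complex.I • f x v := by
    intro x v
    obtain ⟨U, Y, hU, hx, hY, rfl⟩ := exists_holOn_apply_eq x v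
    have hYs := hY.smoothOn hU
    have hIY := hY.const_smul Complex.I
    have e0 := hf U hU Y hYs x hx
    have e1 := hf U hU (Complex.I • Y) (hIY.smoothOn hU) x hx
    have e2 := hf' U hU Y hYs x hx
    have dX := hX.mdifferentiableAt isOpen_univ (Set.mem_univ x)
    rw [realLie_eq_holBracket dX (hY.mdifferentiableAt hU hx)] at e0
    rw [realLie_eq_holBracket dX (hIY.mdifferentiableAt hU hx),
      holBracket_const_smul_right _ hY hU hx, hD.complex U hU X Y hYs x hx, ← smul_sub, e0] at e1
    rw [realLie_eq_holBracket (hIX.mdifferentiableAt isOpen_univ (Set.mem_univ x))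
      (hY.mdifferentiableAt hU hx), holBracket_const_smul_left _ hX isOpen_univ (Set.mem_univ x),
      covOf_I_smul_of_holOn hD X hY hU hx, ← smul_sub, e0] at e2
    exact ⟨e1.symm, e2.symm⟩
  let A : EndoField V M := fun x =>
    { toFun := fun v => f x v
      map_add' := fun v w => (f x).map_add v w
      map_smul' := fun c v => map_complex_smul (fun v => (key x v).1) c v }
  exact ⟨A, fun U hU Y hY x hx => ⟨hf U hU Y hY x hx,
    (hf' U hU Y hY x hx).trans (key x (Y x)).2⟩⟩

end ChernSubLie

/-! ### The unit field and the Euler field -/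

section UnitEuler

variable {V : Type*} [NormedAddCommGroup V] [NormedSpace ℂ V]
  {M : Type*} [TopologicalSpace M] [ChartedSpace V M] [IsManifold 𝓘(ℂ, V) ω M]

/-- A field `Y` solving `A Y = ζ` for a holomorphic invertible `A` and a holomorphic `ζ` is
holomorphic. -/
theorem holOn_of_app_eq [FiniteDimensional ℂ V] {A : EndoField V M} {Y ζ : VField V M}
    (hA : ∀ U : Set M, IsOpen U → ∀ X : VField V M, HolOn X U → HolOn (A.app X) U)
    (hbij : ∀ x, Function.Bijective (A x)) (hζ : HolOn ζ Set.univ) (hY : A.app Y = ζ) :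
    HolOn Y Set.univ := by
  have := FiniteDimensional.complete ℂ V
  intro x₀ _
  refine ContMDiffAt.contMDiffWithinAt ?_
  refine (Bundle.contMDiffAt_section (E := fun x : M => TangentSpace 𝓘(ℂ, V) x) (s := Y) x₀).2 ?_
  have hz := (Bundle.contMDiffAt_section (E := fun x : M => TangentSpace 𝓘(ℂ, V) x) (s := ζ) x₀).1
    ((hζ x₀ trivial).contMDiffAt Filter.univ_mem)
  let t := trivializationAt V (fun x : M => TangentSpace 𝓘(ℂ, V) x) x₀
  let b := Module.finBasis ℂ V
  let c : Fin (Module.finrank ℂ V) → M → V := fun i x => (t ⟨x, A x (t.symm x (b i))⟩).2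
  have hx₀ : x₀ ∈ t.baseSet := FiberBundle.mem_baseSet_trivializationAt' x₀
  have hc : ∀ i, ContMDiffAt 𝓘(ℂ, V) 𝓘(ℂ, V) ω (c i) x₀ := by
    intro i
    have h1 : HolOn (fun x => t.symm x (b i) : VField V M) t.baseSet := by
      intro x hx
      refine (t.contMDiffWithinAt_section _ hx).2 ?_
      refine ContMDiffWithinAt.congr (f := fun _ => b i) contMDiffWithinAt_const ?_ ?_
      · intro y hy
        simp [hy]
      · simp [hx]
    have h2 := hA _ t.open_baseSet _ h1
    exact (Bundle.contMDiffAt_section (E := fun x : M => TangentSpace 𝓘(ℂ, V) x)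
      (s := A.app (fun x => t.symm x (b i) : VField V M)) x₀).1
      ((h2 x₀ hx₀).contMDiffAt (t.open_baseSet.mem_nhds hx₀))
  -- `L` is the matrix of `A` in the trivialization; inversion of matrices is holomorphic.
  let L : M → V →L[ℂ] V := fun x =>
    ∑ i, (LinearMap.toContinuousLinearMap (b.coord i)).smulRight (c i x)
  have hL : ContMDiffAt 𝓘(ℂ, V) 𝓘(ℂ, V →L[ℂ] V) ω L x₀ := by
    refine ContMDiffAt.sum fun i _ => ?_
    exact (((ContinuousLinearMap.smulRightL ℂ V V
      (LinearMap.toContinuousLinearMap (b.coord i))).contDiff (n := ω)).contDiffAt.contMDiffAt).comp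
        x₀ (hc i)
  have hLe : ∀ x (hx : x ∈ t.baseSet) (w : V),
      L x w = t.continuousLinearEquivAt ℂ x hx
        (A x ((t.continuousLinearEquivAt ℂ x hx).symm w)) := by
    intro x hx w
    let T : TangentSpace 𝓘(ℂ, V) x ≃L[ℂ] V := t.continuousLinearEquivAt ℂ x hx
    let g : V →ₗ[ℂ] V := (T.toLinearEquiv : TangentSpace 𝓘(ℂ, V) x →ₗ[ℂ] V) ∘ₗ A x ∘ₗ
      (T.symm.toLinearEquiv : V →ₗ[ℂ] TangentSpace 𝓘(ℂ, V) x)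
    have hg : ∀ i, c i x = g (b i) := fun i => rfl
    change _ = g w
    conv_rhs => rw [← b.sum_repr w]
    simp only [map_sum, map_smul, ← hg]
    simp [L]
  have hinv : ∀ x ∈ t.baseSet, (L x).IsInvertible := by
    intro x hx
    have hb : Function.Bijective (L x) := by
      have : (L x : V → V) = (t.continuousLinearEquivAt ℂ x hx) ∘ (A x) ∘
        (t.continuousLinearEquivAt ℂ x hx).symm := funext (hLe x hx)
      rw [this]
      exact (t.continuousLinearEquivAt ℂ x hx).bijective.comp
        ((hbij x).comp (t.continuousLinearEquivAt ℂ x hx).symm.bijective)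
    exact ⟨(LinearEquiv.ofBijective (L x : V →ₗ[ℂ] V) hb).toContinuousLinearEquiv, by ext; rfl⟩
  have heq : (fun x => (L x).inverse (t ⟨x, ζ x⟩).2) =ᶠ[𝓝 x₀] fun x => (t ⟨x, Y x⟩).2 := by
    filter_upwards [t.open_baseSet.mem_nhds hx₀] with x hx
    have h1 := hLe x hx (t ⟨x, Y x⟩).2
    obtain ⟨e, he⟩ := hinv x hx
    have h2 : (t.continuousLinearEquivAt ℂ x hx).symm (t ⟨x, Y x⟩).2 = Y x :=
      (t.continuousLinearEquivAt ℂ x hx).symm_apply_apply (Y x)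
    have h3 : (t ⟨x, ζ x⟩).2 = e (t ⟨x, Y x⟩).2 := by
      rw [← hY]
      rw [h2, ← he] at h1
      exact h1.symm
    rw [← he, ContinuousLinearMap.inverse_equiv, h3]
    exact e.symm_apply_apply _
  refine ContMDiffAt.congr_of_eventuallyEq ?_ heq.symm
  obtain ⟨e, he⟩ := hinv x₀ hx₀
  have h1 : ContMDiffAt 𝓘(ℂ, V →L[ℂ] V) 𝓘(ℂ, V →L[ℂ] V) ω ContinuousLinearMap.inverse (L x₀) := by
    rw [← he]; exact (contDiffAt_map_inverse e).contMDiffAt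
  exact (h1.comp x₀ hL).clm_apply hz

namespace CVStructure

variable {S : CVStructure V M}

theorem mul_apply (x : M) (u v : TangentSpace 𝓘(ℂ, V) x) : S.mul x u v = -S.C x u v := rfl

theorem C_eq_neg_mul (x : M) (u v : TangentSpace 𝓘(ℂ, V) x) : S.C x u v = -S.mul x u v := by
  rw [mul_apply, neg_neg]

theorem mul_left_comm (x : M) (u v w : TangentSpace 𝓘(ℂ, V) x) :
    S.mul x u (S.mul x v w) = S.mul x v (S.mul x u w) := by
  simp only [mul_apply, map_neg, S.C_comm x u v w]

theorem mul_U (x : M) (u v : TangentSpace 𝓘(ℂ, V) x) :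
    S.mul x u (S.U x v) = S.U x (S.mul x u v) := by
  simp only [mul_apply, map_neg, S.C_U_comm x u v]

theorem g_mul (x : M) (u v w : TangentSpace 𝓘(ℂ, V) x) :
    S.g x (S.mul x u v) w = S.g x v (S.mul x u w) := by
  simp only [mul_apply, map_neg, LinearMap.neg_apply, S.C_g x u v w]

theorem mul_holOn (S : CVStructure V M) {U : Set M} (hU : IsOpen U) {X Y : VField V M}
    (hX : HolOn X U) (hY : HolOn Y U) : HolOn (S.mul.app X Y) U :=
  (S.C_holo U hU X Y hX hY).neg

theorem mul_comm (hsymm : ∀ (x : M) (X Y : TangentSpace 𝓘(ℂ, V) x), S.C x X Y = S.C x Y X)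
    (x : M) (u v : TangentSpace 𝓘(ℂ, V) x) : S.mul x u v = S.mul x v u := by
  rw [mul_apply, mul_apply, hsymm]

theorem mul_assoc (hsymm : ∀ (x : M) (X Y : TangentSpace 𝓘(ℂ, V) x), S.C x X Y = S.C x Y X)
    (x : M) (u v w : TangentSpace 𝓘(ℂ, V) x) :
    S.mul x (S.mul x u v) w = S.mul x u (S.mul x v w) := by
  rw [mul_comm hsymm x _ w, mul_left_comm, mul_comm hsymm x w v]

theorem IsUnitEuler.mul_unit {e Eu : VField V M} (h : S.IsUnitEuler e Eu) (x : M)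
    (v : TangentSpace 𝓘(ℂ, V) x) : S.mul x (e x) v = v := by
  rw [mul_apply, (h.2.2 x v).1, neg_neg]

theorem IsUnitEuler.mul_euler {e Eu : VField V M} (h : S.IsUnitEuler e Eu) (x : M)
    (v : TangentSpace 𝓘(ℂ, V) x) : S.mul x (Eu x) v = S.U x v := by
  rw [mul_apply, (h.2.2 x v).2, neg_neg]

/-- The unit field is the solution `e` of `e ∘ ζ = ζ` for a primitive section `ζ`, and the Euler
field is `𝒰 e`. -/
theorem existsUnique_isUnitEuler [FiniteDimensional ℂ V] (hunf : S.Unfolding)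
    (hsymm : ∀ (x : M) (X Y : TangentSpace 𝓘(ℂ, V) x), S.C x X Y = S.C x Y X) :
    ∃! p : VField V M × VField V M, S.IsUnitEuler p.1 p.2 := by
  obtain ⟨ζ, hζ, hbij⟩ := hunf
  have hbij' : ∀ x, Function.Bijective (S.mul x (ζ x)) := fun x => by
    have : (S.mul x (ζ x) : TangentSpace 𝓘(ℂ, V) x → TangentSpace 𝓘(ℂ, V) x) =
        fun X => -(S.C x X (ζ x)) := by
      ext X; rw [mul_apply, hsymm]
    rw [this]
    exact hbij x
  choose e he using fun x => (hbij' x).2 (ζ x)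
  -- Every `v` is of the form `ζ ∘ w`, hence `e ∘ v = (e ∘ ζ) ∘ w = v`.
  have hunit : ∀ x v, S.mul x (e x) v = v := fun x v => by
    obtain ⟨w, rfl⟩ := (hbij' x).2 v
    rw [mul_left_comm, mul_comm hsymm x (e x) w, mul_left_comm, he, mul_comm hsymm]
  have hhol : HolOn e Set.univ :=
    holOn_of_app_eq (A := S.mul.left ζ)
      (fun U hU X hX => S.mul_holOn hU (hζ.mono (Set.subset_univ U)) hX) hbij' hζ (funext he)
  have hE : S.IsUnitEuler e (S.U.app e) := by
    refine ⟨hhol, S.U_holo _ isOpen_univ e hhol, fun x v => ⟨?_, ?_⟩⟩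
    · rw [C_eq_neg_mul, hunit]
    · have : S.mul x (S.U x (e x)) v = S.U x v := by
        rw [mul_comm hsymm, mul_U, mul_comm hsymm, hunit]
      rw [C_eq_neg_mul]
      exact congrArg _ this
  refine ⟨(e, S.U.app e), hE, ?_⟩
  rintro ⟨e', E'⟩ h
  have h1 : e' = e := by
    ext x
    rw [← hunit x (e' x), mul_comm hsymm, h.mul_unit]
  have h2 : E' = S.U.app e := by
    ext x
    rw [← hunit x (E' x), mul_comm hsymm, h.mul_euler]
    rfl
  rw [h1, h2]

end CVStructure

end UnitEuler

/-! ### The F-manifold -/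

section FManifoldStructure

variable {V : Type*} [NormedAddCommGroup V] [NormedSpace ℂ V]
  {M : Type*} [TopologicalSpace M] [ChartedSpace V M] [IsManifold 𝓘(ℂ, V) ω M]

namespace CVStructure

variable {S : CVStructure V M}

theorem holPart_cov_neg (X : VField V M) {Y : VField V M} {U : Set M} (hY : SmoothOn Y U)
    (hU : IsOpen U) {x : M} (hx : x ∈ U) :
    holPart S.cov X (-Y) x = -holPart S.cov X Y x := by
  simp only [holPart, cov, covOf_neg S.D _ hY hU hx, smul_neg, ← neg_sub']

/-- The potentiality `D_X(Y ∘) - D_Y(X ∘) = [X, Y] ∘` of the multiplication. -/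
theorem cov_mul_sub_cov_mul (S : CVStructure V M) {U : Set M} (hU : IsOpen U)
    {X Y Z : VField V M} (hX : HolOn X U) (hY : HolOn Y U) (hZ : HolOn Z U) {x : M} (hx : x ∈ U) :
    holPart S.cov X (S.mul.app Y Z) x - S.mul x (Y x) (holPart S.cov X Z x)
      - (holPart S.cov Y (S.mul.app X Z) x - S.mul x (X x) (holPart S.cov Y Z x))
      = S.mul x (holBracket X Y x) (Z x) := by
  have h := S.D_C U hU X Y Z hX hY (hZ.smoothOn hU) x hx
  have e : ∀ W : VField V M, S.C.app W Z = -S.mul.app W Z := fun W => by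
    ext y; simp [ProdField.app, mul_apply]
  have hs : ∀ W : VField V M, HolOn W U → SmoothOn (S.mul.app W Z) U := fun W hW =>
    (S.mul_holOn hU hW hZ).smoothOn hU
  change (holPart S.cov X (S.C.app Y Z) x - S.C x (Y x) (holPart S.cov X Z x))
        - (holPart S.cov Y (S.C.app X Z) x - S.C x (X x) (holPart S.cov Y Z x))
        - S.C x (holBracket X Y x) (Z x) = 0 at h
  rw [e, e, holPart_cov_neg X (hs Y hY) hU hx, holPart_cov_neg Y (hs X hX) hU hx] at h
  simp only [C_eq_neg_mul] at h
  rw [← sub_eq_zero, ← neg_eq_zero, ← h]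
  abel

/-- The equation `D_X(𝒰) - [C_X, 𝒬] + C_X = 0` in terms of the Euler field. -/
theorem cov_mul_euler {e Eu : VField V M} (hE : S.IsUnitEuler e Eu)
    {U : Set M} (hU : IsOpen U) {X Y : VField V M} (hX : HolOn X U)
    (hY : HolOn Y U) {x : M} (hx : x ∈ U) :
    holPart S.cov X (S.mul.app Eu Y) x - S.mul x (Eu x) (holPart S.cov X Y x)
      = S.Q x (S.mul x (X x) (Y x)) - S.mul x (X x) (S.Q x (Y x)) + S.mul x (X x) (Y x) := by
  have h := S.D_U U hU X Y (hX.smoothOn hU) (hY.smoothOn hU) x hx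
  have e1 : S.mul.app Eu Y = S.U.app Y := by
    ext y; exact hE.mul_euler y (Y y)
  change (holPart S.cov X (S.U.app Y) x - S.U x (holPart S.cov X Y x))
      - (S.C x (X x) (S.Q x (Y x)) - S.Q x (S.C x (X x) (Y x))) + S.C x (X x) (Y x) = 0 at h
  simp only [C_eq_neg_mul, map_neg] at h
  rw [e1, hE.mul_euler, ← sub_eq_zero, ← h]
  abel

theorem cov_mul_unit {e Eu : VField V M} (hE : S.IsUnitEuler e Eu) (X Y : VField V M) (x : M) :
    holPart S.cov X (S.mul.app e Y) x - S.mul x (e x) (holPart S.cov X Y x) = 0 := by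
  have e1 : S.mul.app e Y = Y := by
    ext y; exact hE.mul_unit y (Y y)
  rw [e1, hE.mul_unit, sub_self]

/-- The Lie derivative of the multiplication along `X` in terms of the endomorphisms `D_Z(X ∘)`:
its three brackets are replaced by means of `cov_mul_sub_cov_mul`, and the terms `D_X` cancel.
Hence it is determined by the failure of `X ∘` to be parallel in `(1,0)`-directions. -/
theorem lieMul_mul (hsymm : ∀ (x : M) (X Y : TangentSpace 𝓘(ℂ, V) x), S.C x X Y = S.C x Y X)
    {U : Set M} (hU : IsOpen U) {X Z W Y : VField V M} (hX : HolOn X U)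
    (hZ : HolOn Z U) (hW : HolOn W U) (hY : HolOn Y U) {x : M} (hx : x ∈ U) :
    S.mul x (lieMul S.mul X Z W x) (Y x) =
      -(holPart S.cov (S.mul.app Z W) (S.mul.app X Y) x
          - S.mul x (X x) (holPart S.cov (S.mul.app Z W) Y x))
        + (holPart S.cov Z (S.mul.app X (S.mul.app W Y)) x
          - S.mul x (X x) (holPart S.cov Z (S.mul.app W Y) x))
        + S.mul x (Z x) (holPart S.cov W (S.mul.app X Y) x
          - S.mul x (X x) (holPart S.cov W Y x)) := by
  have h1 := S.cov_mul_sub_cov_mul hU hX (S.mul_holOn hU hZ hW) hY hx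
  have h2 := S.cov_mul_sub_cov_mul hU hX hZ (S.mul_holOn hU hW hY) hx
  have h3 := S.cov_mul_sub_cov_mul hU hX hW hY hx
  have e1 : S.mul.app (S.mul.app Z W) Y = S.mul.app Z (S.mul.app W Y) := by
    ext y; exact mul_assoc hsymm y _ _ _
  have e2 : lieMul S.mul X Z W x = holBracket X (S.mul.app Z W) x
    - S.mul x (holBracket X Z x) (W x) - S.mul x (Z x) (holBracket X W x) := rfl
  have e3 : S.mul.app W Y x = S.mul x (W x) (Y x) := rfl
  have e4 : S.mul.app Z W x = S.mul x (Z x) (W x) := rfl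
  rw [e2, map_sub, map_sub, LinearMap.sub_apply, LinearMap.sub_apply, ← h1,
    mul_assoc hsymm x (holBracket X Z x), ← e3, ← h2, mul_assoc hsymm x (Z x), ← h3, e1, e4,
    mul_assoc hsymm x (Z x) (W x)]
  simp only [map_sub]
  abel

/-- The integrability condition of an F-manifold is formal from `lieMul_mul`, because
`D_Z(X ∘ Y ∘) = D_Z(X ∘) (Y ∘) + (X ∘) D_Z(Y ∘)`. -/
theorem lieMul_mul_left
    (hsymm : ∀ (x : M) (X Y : TangentSpace 𝓘(ℂ, V) x), S.C x X Y = S.C x Y X)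
    {e Eu : VField V M} (hE : S.IsUnitEuler e Eu)
    {U : Set M} (hU : IsOpen U) {X Y Z W : VField V M} (hX : HolOn X U) (hY : HolOn Y U)
    (hZ : HolOn Z U) (hW : HolOn W U) {x : M} (hx : x ∈ U) :
    lieMul S.mul (S.mul.app X Y) Z W x
      = S.mul x (X x) (lieMul S.mul Y Z W x) + S.mul x (Y x) (lieMul S.mul X Z W x) := by
  have he : HolOn e U := hE.1.mono (Set.subset_univ U)
  -- `L_{X ∘ Y}` and `L_Y` are evaluated on `e` but `L_X` on `Y`, so that the Leibniz rule for
  -- `X ∘ Y ∘` is applied to `e` in all terms.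
  have h1 := lieMul_mul hsymm hU (S.mul_holOn hU hX hY) hZ hW he hx
  have h2 := lieMul_mul hsymm hU hX hZ hW (S.mul_holOn hU hY he) hx
  have h3 := lieMul_mul hsymm hU hY hZ hW he hx
  have hr : ∀ v, S.mul x v (e x) = v := fun v => by rw [mul_comm hsymm, hE.mul_unit]
  have e0 : S.mul.app Y e = Y := by
    ext y; exact (mul_comm hsymm y _ _).trans (hE.mul_unit y _)
  have e1 : S.mul.app W e = W := by
    ext y; exact (mul_comm hsymm y _ _).trans (hE.mul_unit y _)
  have e2 : S.mul.app (S.mul.app X Y) e = S.mul.app X Y := by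
    ext y; exact (mul_comm hsymm y _ _).trans (hE.mul_unit y _)
  have e3 : S.mul.app (S.mul.app X Y) W = S.mul.app X (S.mul.app Y W) := by
    ext y; exact mul_assoc hsymm y _ _ _
  have e4 : S.mul.app W Y = S.mul.app Y W := by
    ext y; exact mul_comm hsymm y _ _
  have e5 : S.mul.app X Y x = S.mul x (X x) (Y x) := rfl
  rw [hr, e2, e1, e3, e5] at h1
  rw [e0, e4] at h2
  rw [hr, e0, e1] at h3
  rw [h1, mul_comm hsymm x (Y x), h2, h3]
  simp only [map_sub, map_add, map_neg, mul_assoc hsymm x (X x) (Y x),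
    mul_left_comm x (X x) (Z x)]
  abel

/-- `L_E(∘) = ∘`, as `D_Z(E ∘) = [𝒬, Z ∘] + Z ∘`: in `lieMul_mul` the commutators with `𝒬` cancel.
-/
theorem lieMul_euler (hsymm : ∀ (x : M) (X Y : TangentSpace 𝓘(ℂ, V) x), S.C x X Y = S.C x Y X)
    {e Eu : VField V M} (hE : S.IsUnitEuler e Eu)
    {U : Set M} (hU : IsOpen U) {Z W : VField V M}
    (hZ : HolOn Z U) (hW : HolOn W U) {x : M} (hx : x ∈ U) :
    lieMul S.mul Eu Z W x = S.mul x (Z x) (W x) := by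
  have he : HolOn e U := hE.1.mono (Set.subset_univ U)
  have h1 := lieMul_mul hsymm hU (hE.2.1.mono (Set.subset_univ U)) hZ hW he hx
  have hr : ∀ v, S.mul x v (e x) = v := fun v => by rw [mul_comm hsymm, hE.mul_unit]
  have e1 : S.mul.app W e = W := by
    ext y; exact (mul_comm hsymm y _ _).trans (hE.mul_unit y _)
  have e2 : S.mul.app Z W x = S.mul x (Z x) (W x) := rfl
  rw [hr, cov_mul_euler hE hU (S.mul_holOn hU hZ hW) he hx,
    cov_mul_euler hE hU hZ (S.mul_holOn hU hW he) hx, cov_mul_euler hE hU hW he hx, e1, e2] at h1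
  simp only [hr, map_add, map_sub, mul_assoc hsymm x (Z x)] at h1
  rw [h1]
  abel

theorem lieMul_unit (hsymm : ∀ (x : M) (X Y : TangentSpace 𝓘(ℂ, V) x), S.C x X Y = S.C x Y X)
    {e Eu : VField V M} (hE : S.IsUnitEuler e Eu)
    {U : Set M} (hU : IsOpen U) {Z W : VField V M}
    (hZ : HolOn Z U) (hW : HolOn W U) {x : M} (hx : x ∈ U) :
    lieMul S.mul e Z W x = 0 := by
  have he : HolOn e U := hE.1.mono (Set.subset_univ U)
  have h1 := lieMul_mul hsymm hU he hZ hW he hx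
  have hr : ∀ v, S.mul x v (e x) = v := fun v => by rw [mul_comm hsymm, hE.mul_unit]
  rw [hr, cov_mul_unit hE, cov_mul_unit hE, cov_mul_unit hE] at h1
  simpa using h1

theorem isFManifold (hsymm : ∀ (x : M) (X Y : TangentSpace 𝓘(ℂ, V) x), S.C x X Y = S.C x Y X)
    {e Eu : VField V M} (hE : S.IsUnitEuler e Eu) : IsFManifold S.mul e Eu where
  holo _ hU _ _ hX hY := S.mul_holOn hU hX hY
  comm := mul_comm hsymm
  assoc := mul_assoc hsymm
  unit_holo := hE.1
  unit := hE.mul_unit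
  integrable _ hU _ _ _ _ hX hY hZ hW _ hx := lieMul_mul_left hsymm hE hU hX hY hZ hW hx
  euler_holo := hE.2.1
  euler _ hU _ _ hZ hW _ hx := lieMul_euler hsymm hE hU hZ hW hx

end CVStructure

end FManifoldStructure

/-! ### Fields which are constant in a chart -/

section ConstantFields

variable {V : Type*} [NormedAddCommGroup V] [NormedSpace ℂ V]
  {M : Type*} [TopologicalSpace M] [ChartedSpace V M]

theorem contMDiffAt_complex_mul {f f' : M → ℂ} {x : M}
    (hf : ContMDiffAt 𝓘(ℝ, V) 𝓘(ℝ, ℂ) ∞ f x) (hf' : ContMDiffAt 𝓘(ℝ, V) 𝓘(ℝ, ℂ) ∞ f' x) :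
    ContMDiffAt 𝓘(ℝ, V) 𝓘(ℝ, ℂ) ∞ (fun y => f y * f' y) x :=
  (contDiff_mul (𝕜 := ℝ) (𝔸 := ℂ)).contDiffAt.comp_contMDiffAt (hf.prodMk_space hf')

variable [IsManifold 𝓘(ℂ, V) ω M]

/-- The vector field with constant coordinate `v` in the trivialization of `TM` at `p`, extended by
zero outside of the domain of the chart at `p`. -/
def constField (p : M) (v : V) : VField V M := fun x =>
  (trivializationAt V (fun x : M => TangentSpace 𝓘(ℂ, V) x) p).symmL ℂ x v

/-- The coordinate of a tangent vector at `x` in the trivialization of `TM` at `p`; it is zero if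
`x` is not in the domain of the chart at `p`. -/
def coordAt (p : M) (x : M) : TangentSpace 𝓘(ℂ, V) x →L[ℂ] V :=
  (trivializationAt V (fun x : M => TangentSpace 𝓘(ℂ, V) x) p).continuousLinearMapAt ℂ x

theorem coordAt_apply (p : M) {x : M} (hx : x ∈ (chartAt V p).source)
    (v : TangentSpace 𝓘(ℂ, V) x) : coordAt p x v =
    (trivializationAt V (TangentSpace 𝓘(ℂ, V)) p (⟨x, v⟩ : TangentBundle 𝓘(ℂ, V) M)).2 := by
  have hx' : x ∈ (trivializationAt V (fun x : M => TangentSpace 𝓘(ℂ, V) x) p).baseSet := hx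
  exact Bundle.Trivialization.continuousLinearMapAt_apply_of_mem _ _ hx' v

theorem constField_coordAt (p : M) {x : M} (hx : x ∈ (chartAt V p).source)
    (v : TangentSpace 𝓘(ℂ, V) x) : constField p (coordAt p x v) x = v := by
  have hx' : x ∈ (trivializationAt V (fun x : M => TangentSpace 𝓘(ℂ, V) x) p).baseSet := hx
  exact Bundle.Trivialization.symmL_continuousLinearMapAt (R := ℂ) _ hx' v

theorem coordAt_constField (p : M) {x : M} (hx : x ∈ (chartAt V p).source) (v : V) :
    coordAt p x (constField p v x) = v := by
  have hx' : x ∈ (trivializationAt V (fun x : M => TangentSpace 𝓘(ℂ, V) x) p).baseSet := hx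
  exact Bundle.Trivialization.continuousLinearMapAt_symmL (R := ℂ) _ hx' v

theorem constField_holOn (p : M) (v : V) : HolOn (constField p v) (chartAt V p).source := by
  intro x hx
  let t := trivializationAt V (fun x : M => TangentSpace 𝓘(ℂ, V) x) p
  have hx' : x ∈ t.baseSet := hx
  refine (t.contMDiffWithinAt_section _ hx').2 ?_
  have h : ∀ y ∈ (chartAt V p).source, (t ⟨y, constField p v y⟩).2 = v := fun y hy => by
    rw [← coordAt_apply p hy, coordAt_constField p hy]
  exact ContMDiffWithinAt.congr (f := fun _ => v) contMDiffWithinAt_const h (h x hx)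

theorem constField_add (p x : M) (v w : V) :
    constField p (v + w) x = constField p v x + constField p w x :=
  map_add ((trivializationAt V (fun x : M => TangentSpace 𝓘(ℂ, V) x) p).symmL ℂ x) v w

theorem constField_smul (p x : M) (c : ℂ) (v : V) :
    constField p (c • v) x = c • constField p v x :=
  map_smul ((trivializationAt V (fun x : M => TangentSpace 𝓘(ℂ, V) x) p).symmL ℂ x) c v

theorem constField_sum (p x : M) {ι : Type*} (s : Finset ι) (v : ι → V) :
    constField p (∑ i ∈ s, v i) x = ∑ i ∈ s, constField p (v i) x :=
  map_sum ((trivializationAt V (fun x : M => TangentSpace 𝓘(ℂ, V) x) p).symmL ℂ x) v s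

/-- The coordinate of a smooth vector field in the trivialization at `p` is smooth. -/
theorem SmoothOn.contMDiffAt_coordAt {Y : VField V M} {U : Set M} (hY : SmoothOn Y U)
    (hU : IsOpen U) {p : M} (hp : p ∈ U) :
    ContMDiffAt 𝓘(ℝ, V) 𝓘(ℝ, V) ∞ (fun x => coordAt p x (Y x)) p := by
  have h1 := (Bundle.contMDiffAt_section (E := fun x : M => TangentSpace 𝓘(ℝ, V) x) (s := Y) p).1
    ((hY p hp).contMDiffAt (hU.mem_nhds hp))
  refine h1.congr_of_eventuallyEq ?_
  filter_upwards [(chartAt V p).open_source.mem_nhds (mem_chart_source V p)] with x hx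
  rw [coordAt_apply p hx]
  exact (trivializationAt_real_eq p hx (Y x)).symm

/-- A holomorphic bilinear form takes smooth values on smooth vector fields. -/
theorem smoothFunOn_bilin_app [FiniteDimensional ℂ V] {g : BilinField V M}
    (hg : ∀ N : Set M, IsOpen N → ∀ Y Z : VField V M, HolOn Y N → HolOn Z N →
      HolFunOn (V := V) (g.app Y Z) N)
    {Y Z : VField V M} {U : Set M} (hU : IsOpen U) (hY : SmoothOn Y U) (hZ : SmoothOn Z U) :
    SmoothFunOn (V := V) (g.app Y Z) U := by
  intro p hp
  refine ContMDiffAt.contMDiffWithinAt ?_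
  let b := Module.finBasis ℂ V
  let F : Fin (Module.finrank ℂ V) → VField V M := fun i => constField p (b i)
  have hexp : ∀ (Y : VField V M) (x : M), x ∈ (chartAt V p).source →
      Y x = ∑ i, b.coord i (coordAt p x (Y x)) • F i x := by
    intro Y x hx
    conv_lhs => rw [← constField_coordAt p hx (Y x), ← b.sum_repr (coordAt p x (Y x)),
      constField_sum]
    exact Finset.sum_congr rfl fun i _ => constField_smul p x _ _
  have hcoef : ∀ Y : VField V M, SmoothOn Y U → ∀ i, ContMDiffAt 𝓘(ℝ, V) 𝓘(ℝ, ℂ) ∞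
      (fun x => b.coord i (coordAt p x (Y x))) p := by
    intro Y hY i
    have h1 : ContDiff ℝ ∞ (fun v : V => b.coord i v) :=
      ((LinearMap.toContinuousLinearMap (b.coord i)).restrictScalars ℝ).contDiff
    exact h1.contDiffAt.comp_contMDiffAt (hY.contMDiffAt_coordAt hU hp)
  have hF : ∀ i j, ContMDiffAt 𝓘(ℝ, V) 𝓘(ℝ, ℂ) ∞ (g.app (F i) (F j)) p := by
    intro i j
    have h1 := hg _ (chartAt V p).open_source (F i) (F j) (constField_holOn p _)
      (constField_holOn p _) p (mem_chart_source V p)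
    exact (contMDiffAt_restrictScalars (h1.contMDiffAt
      ((chartAt V p).open_source.mem_nhds (mem_chart_source V p)))).of_le le_top
  have hsum : ContMDiffAt 𝓘(ℝ, V) 𝓘(ℝ, ℂ) ∞ (fun x => ∑ i, ∑ j,
      b.coord i (coordAt p x (Y x)) * (b.coord j (coordAt p x (Z x)) * g.app (F i) (F j) x)) p :=
    ContMDiffAt.sum fun i _ => ContMDiffAt.sum fun j _ =>
      contMDiffAt_complex_mul (hcoef Y hY i) (contMDiffAt_complex_mul (hcoef Z hZ j) (hF i j))
  refine hsum.congr_of_eventuallyEq ?_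
  filter_upwards [(chartAt V p).open_source.mem_nhds (mem_chart_source V p)] with x hx
  have e1 : g.app Y Z x = g x (∑ i, b.coord i (coordAt p x (Y x)) • F i x)
      (∑ i, b.coord i (coordAt p x (Z x)) • F i x) := by
    rw [← hexp Y x hx, ← hexp Z x hx]; rfl
  rw [e1]
  simp only [map_sum, map_smul, LinearMap.sum_apply, LinearMap.smul_apply, smul_eq_mul]
  simp only [Finset.mul_sum]
  rw [Finset.sum_comm]
  refine Finset.sum_congr rfl fun i _ => Finset.sum_congr rfl fun j _ => ?_
  rw [_root_.mul_left_comm]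
  rfl

end ConstantFields

/-! ### The difference of `D` and the Lie derivative on a CV-structure -/

section CovSubLie

variable {V : Type*} [NormedAddCommGroup V] [NormedSpace ℂ V]
  {M : Type*} [TopologicalSpace M] [ChartedSpace V M] [IsManifold 𝓘(ℂ, V) ω M]

theorem holPart_realLie_of_holOn [CompleteSpace V] {X Y : VField V M} {U : Set M} (hU : IsOpen U)
    (hX : HolOn X U) (hY : HolOn Y U) {x : M} (hx : x ∈ U) :
    holPart realLie X Y x = holBracket X Y x := by
  have dY := hY.mdifferentiableAt hU hx
  simp only [holPart]
  rw [realLie_eq_holBracket (hX.mdifferentiableAt hU hx) dY,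
    realLie_eq_holBracket ((hX.const_smul Complex.I).mdifferentiableAt hU hx) dY,
    holBracket_const_smul_left _ hX hU hx, smul_smul, Complex.I_mul_I, neg_one_smul, sub_neg_eq_add,
    ← two_smul ℂ, smul_smul]
  norm_num

namespace CVStructure

variable {S : CVStructure V M}

/-- `A` is the endomorphism field `D_X - L_X` on `(1,0)`-fields, for a holomorphic field `X`. The
two equations, for the real fields underlying `X` and `iX`, say that `D - L` is `A` in the
direction of the `(1,0)`-field `X` and vanishes in the direction of its conjugate. -/
def IsCovSubLie (S : CVStructure V M) (X : VField V M) (A : EndoField V M) : Prop :=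
  ∀ U : Set M, IsOpen U → ∀ Y : VField V M, SmoothOn Y U → ∀ x ∈ U,
    S.cov X Y x - realLie X Y x = A x (Y x) ∧
    S.cov (Complex.I • X) Y x - realLie (Complex.I • X) Y x = Complex.I • A x (Y x)

/-- Both `D` and the Lie derivative act as the `∂̄`-operator in the direction conjugate to a
holomorphic field, and their difference is tensorial. -/
theorem exists_isCovSubLie [FiniteDimensional ℂ V] (S : CVStructure V M) {X : VField V M}
    (hX : HolOn X Set.univ) : ∃ A, S.IsCovSubLie X A :=
  exists_endoField_covOf_sub_realLie S.chern hX

section IsCovSubLie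

variable {X : VField V M} {A : EndoField V M}

theorem IsCovSubLie.holPart_eq (hA : S.IsCovSubLie X A) {U : Set M} (hU : IsOpen U)
    {Y : VField V M} (hY : SmoothOn Y U) {x : M} (hx : x ∈ U) :
    holPart realLie X Y x = holPart S.cov X Y x - A x (Y x) := by
  obtain ⟨h1, h2⟩ := hA U hU Y hY x hx
  simp only [holPart]
  rw [sub_eq_iff_eq_add.1 h1, sub_eq_iff_eq_add.1 h2]
  simp only [smul_sub, smul_add, smul_smul, Complex.I_mul_I, neg_one_smul]
  module

theorem IsCovSubLie.antiPart_eq (hA : S.IsCovSubLie X A) {U : Set M} (hU : IsOpen U)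
    {Y : VField V M} (hY : SmoothOn Y U) {x : M} (hx : x ∈ U) :
    antiPart realLie X Y x = antiPart S.cov X Y x := by
  obtain ⟨h1, h2⟩ := hA U hU Y hY x hx
  simp only [antiPart]
  rw [sub_eq_iff_eq_add.1 h1, sub_eq_iff_eq_add.1 h2]
  simp only [smul_add, smul_smul, Complex.I_mul_I, neg_one_smul]
  module

/-- The commutator of `D_X - L_X` with `Z ∘`. By potentiality it does not involve derivatives
along `X` except for `L_X(∘)`. -/
theorem IsCovSubLie.map_mul [CompleteSpace V] (hA : S.IsCovSubLie X A) {U : Set M} (hU : IsOpen U)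
    (hX : HolOn X U) {Z W : VField V M} (hZ : HolOn Z U) (hW : HolOn W U) {x : M} (hx : x ∈ U) :
    A x (S.mul x (Z x) (W x)) - S.mul x (Z x) (A x (W x)) =
      holPart S.cov Z (S.mul.app X W) x - S.mul x (X x) (holPart S.cov Z W x)
        - lieMul S.mul X Z W x := by
  have hZW := S.mul_holOn hU hZ hW
  have h1 := hA.holPart_eq hU (hZW.smoothOn hU) hx
  have h2 := hA.holPart_eq hU (hW.smoothOn hU) hx
  rw [holPart_realLie_of_holOn hU hX hZW hx] at h1
  rw [holPart_realLie_of_holOn hU hX hW hx] at h2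
  have h3 := S.cov_mul_sub_cov_mul hU hX hZ hW hx
  have e2 : lieMul S.mul X Z W x = holBracket X (S.mul.app Z W) x
    - S.mul x (holBracket X Z x) (W x) - S.mul x (Z x) (holBracket X W x) := rfl
  have e4 : S.mul.app Z W x = S.mul x (Z x) (W x) := rfl
  rw [e2, h1, h2, ← h3, e4, map_sub]
  abel

/-- The endomorphism `D_E - L_E - 𝒬` commutes with multiplication. -/
theorem IsCovSubLie.euler_map_mul [CompleteSpace V]
    (hsymm : ∀ (x : M) (X Y : TangentSpace 𝓘(ℂ, V) x), S.C x X Y = S.C x Y X)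
    {e Eu : VField V M} (hE : S.IsUnitEuler e Eu) {A : EndoField V M} (hA : S.IsCovSubLie Eu A)
    (x : M) (u v : TangentSpace 𝓘(ℂ, V) x) :
    (A x - S.Q x) (S.mul x u v) = S.mul x u ((A x - S.Q x) v) := by
  obtain ⟨U, Z, hU, hx, hZ, rfl⟩ := exists_holOn_apply_eq x u
  obtain ⟨U', W, hU', hx', hW, rfl⟩ := exists_holOn_apply_eq x v
  have hUU := hU.inter hU'
  have hxx : x ∈ U ∩ U' := ⟨hx, hx'⟩
  have hZ' := hZ.mono (U' := U ∩ U') Set.inter_subset_left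
  have hW' := hW.mono (U' := U ∩ U') Set.inter_subset_right
  have h := hA.map_mul hUU (hE.2.1.mono (Set.subset_univ _)) hZ' hW' hxx
  rw [cov_mul_euler hE hUU hZ' hW' hxx, lieMul_euler hsymm hE hUU hZ' hW' hxx] at h
  simp only [LinearMap.sub_apply, map_sub]
  rw [← sub_eq_zero] at h ⊢
  rw [← h]
  abel

/-- The endomorphism `D_e - L_e` commutes with multiplication. -/
theorem IsCovSubLie.unit_map_mul [CompleteSpace V]
    (hsymm : ∀ (x : M) (X Y : TangentSpace 𝓘(ℂ, V) x), S.C x X Y = S.C x Y X)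
    {e Eu : VField V M} (hE : S.IsUnitEuler e Eu) {A : EndoField V M} (hA : S.IsCovSubLie e A)
    (x : M) (u v : TangentSpace 𝓘(ℂ, V) x) :
    A x (S.mul x u v) = S.mul x u (A x v) := by
  obtain ⟨U, Z, hU, hx, hZ, rfl⟩ := exists_holOn_apply_eq x u
  obtain ⟨U', W, hU', hx', hW, rfl⟩ := exists_holOn_apply_eq x v
  have hUU := hU.inter hU'
  have hxx : x ∈ U ∩ U' := ⟨hx, hx'⟩
  have hZ' := hZ.mono (U' := U ∩ U') Set.inter_subset_left
  have hW' := hW.mono (U' := U ∩ U') Set.inter_subset_right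
  have h := hA.map_mul hUU (hE.1.mono (Set.subset_univ _)) hZ' hW' hxx
  rw [cov_mul_unit hE, lieMul_unit hsymm hE hUU hZ' hW' hxx, sub_zero, sub_eq_zero] at h
  exact h

end IsCovSubLie

/-- An endomorphism commuting with multiplication is multiplication with its value on the unit
field. -/
theorem eq_mul_apply_unit
    (hsymm : ∀ (x : M) (X Y : TangentSpace 𝓘(ℂ, V) x), S.C x X Y = S.C x Y X)
    {e Eu : VField V M} (hE : S.IsUnitEuler e Eu) {x : M}
    {B : TangentSpace 𝓘(ℂ, V) x →ₗ[ℂ] TangentSpace 𝓘(ℂ, V) x}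
    (hB : ∀ u v, B (S.mul x u v) = S.mul x u (B v)) (u : TangentSpace 𝓘(ℂ, V) x) :
    B u = S.mul x (B (e x)) u := by
  rw [mul_comm hsymm, ← hB, mul_comm hsymm, hE.mul_unit]

/-- An endomorphism commuting with multiplication is a multiplication, hence `g`-symmetric. -/
theorem g_symm_of_map_mul
    (hsymm : ∀ (x : M) (X Y : TangentSpace 𝓘(ℂ, V) x), S.C x X Y = S.C x Y X)
    {e Eu : VField V M} (hE : S.IsUnitEuler e Eu) {x : M}
    {B : TangentSpace 𝓘(ℂ, V) x →ₗ[ℂ] TangentSpace 𝓘(ℂ, V) x}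
    (hB : ∀ u v, B (S.mul x u v) = S.mul x u (B v)) (u v : TangentSpace 𝓘(ℂ, V) x) :
    S.g x (B u) v = S.g x u (B v) := by
  rw [eq_mul_apply_unit hsymm hE hB u, eq_mul_apply_unit hsymm hE hB v, g_mul]

/-! ### Compatibility of the Chern connection with the other structures -/

theorem h_app_eq (Y Z : VField V M) : S.h.app Y Z = S.g.app Y (S.κ.app Z) := by
  ext x; exact S.h_eq x _ _

theorem along_fn_h (S : CVStructure V M) (X : VField V M) {U : Set M} (hU : IsOpen U)
    {Y Z : VField V M} (hY : SmoothOn Y U) (hZ : SmoothOn Z U) {x : M} (hx : x ∈ U) :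
    (along S.cov X).fn (S.h.app Y Z) x
      = S.h x (holPart S.cov X Y x) (Z x) + S.h x (Y x) (antiPart S.cov X Z x) := by
  have h1 := S.chern.metric U hU X Y Z hY hZ x hx
  have h2 := S.chern.metric U hU (Complex.I • X) Y Z hY hZ x hx
  simp only [along, holPart, antiPart, h1, h2, cov, map_smul, map_sub, map_add,
    LinearMap.smul_apply, LinearMap.sub_apply, LinearMap.map_smulₛₗ, smul_eq_mul, map_div₀,
    map_one, map_ofNat, Complex.conj_I]
  ring

theorem alongBar_fn_h (S : CVStructure V M) (X : VField V M) {U : Set M} (hU : IsOpen U)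
    {Y Z : VField V M} (hY : SmoothOn Y U) (hZ : SmoothOn Z U) {x : M} (hx : x ∈ U) :
    (alongBar S.cov X).fn (S.h.app Y Z) x
      = S.h x (antiPart S.cov X Y x) (Z x) + S.h x (Y x) (holPart S.cov X Z x) := by
  have h1 := S.chern.metric U hU X Y Z hY hZ x hx
  have h2 := S.chern.metric U hU (Complex.I • X) Y Z hY hZ x hx
  simp only [alongBar, holPart, antiPart, h1, h2, cov, map_smul, map_sub, map_add,
    LinearMap.smul_apply, LinearMap.add_apply, LinearMap.map_smulₛₗ, smul_eq_mul, map_div₀,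
    map_one, map_ofNat, Complex.conj_I]
  ring

theorem holPart_cov_κ (S : CVStructure V M) (X : VField V M) {U : Set M} (hU : IsOpen U)
    {Y : VField V M} (hY : SmoothOn Y U) {x : M} (hx : x ∈ U) :
    holPart S.cov X (S.κ.app Y) x = S.κ x (antiPart S.cov X Y x) := by
  have h1 := S.D_κ U hU X Y hY x hx
  have h2 := S.D_κ U hU (Complex.I • X) Y hY x hx
  simp only [holPart, antiPart, cov, h1, h2, LinearMap.map_smulₛₗ, map_add, map_div₀,
    map_one, map_ofNat, Complex.conj_I, neg_smul, sub_eq_add_neg]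

theorem antiPart_cov_κ (S : CVStructure V M) (X : VField V M) {U : Set M} (hU : IsOpen U)
    {Y : VField V M} (hY : SmoothOn Y U) {x : M} (hx : x ∈ U) :
    antiPart S.cov X (S.κ.app Y) x = S.κ x (holPart S.cov X Y x) := by
  have h1 := S.D_κ U hU X Y hY x hx
  have h2 := S.D_κ U hU (Complex.I • X) Y hY x hx
  simp only [holPart, antiPart, cov, h1, h2, LinearMap.map_smulₛₗ, map_sub, map_div₀,
    map_one, map_ofNat, Complex.conj_I, neg_smul, sub_neg_eq_add]

theorem along_fn_g (S : CVStructure V M) (X : VField V M) {U : Set M} (hU : IsOpen U)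
    {Y Z : VField V M} (hY : SmoothOn Y U) (hZ : SmoothOn Z U) {x : M} (hx : x ∈ U) :
    (along S.cov X).fn (S.g.app Y Z) x
      = S.g x (holPart S.cov X Y x) (Z x) + S.g x (Y x) (holPart S.cov X Z x) := by
  have e : S.g.app Y Z = S.h.app Y (S.κ.app Z) := by
    ext y
    simp only [h_app_eq, BilinField.app, ConjField.app, S.κ_sq]
  rw [e, S.along_fn_h X hU hY (S.κ_smooth U hU Z hZ) hx, S.antiPart_cov_κ X hU hZ hx, S.h_eq,
    S.h_eq, S.κ_sq]
  simp only [ConjField.app, S.κ_sq]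

/-- `𝒬` is `h`-selfadjoint and `g`-skew-symmetric, hence anticommutes with `κ`. -/
theorem Q_κ (x : M) (v : TangentSpace 𝓘(ℂ, V) x) : S.Q x (S.κ x v) = -S.κ x (S.Q x v) := by
  refine eq_neg_of_add_eq_zero_left ((S.g_nondeg x).2 _ fun a => ?_)
  rw [map_add, ← S.h_eq x a, ← S.Q_h, S.h_eq, S.Q_g, add_neg_cancel]

theorem holPart_cov_Q (S : CVStructure V M) (X : VField V M) {U : Set M} (hU : IsOpen U)
    (hX : SmoothOn X U) {Y : VField V M} (hY : SmoothOn Y U) {x : M} (hx : x ∈ U) :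
    holPart S.cov X (S.Q.app Y) x - S.Q x (holPart S.cov X Y x)
      = comm (S.mul.left X) (conjBy S.κ S.U) x (Y x) := by
  have h := S.D_Q U hU X Y hX hY x hx
  have e : comm (S.mul.left X) (conjBy S.κ S.U) x (Y x)
      = -comm (S.C.left X) (conjBy S.κ S.U) x (Y x) := by
    simp [comm, ProdField.left, mul_apply]
    abel
  rw [e]
  exact eq_neg_of_add_eq_zero_left h

/-- The conjugate of `D_X(𝒬) = [X ∘, κ 𝒰 κ]`, as `𝒬 = -κ 𝒬 κ` and `κ` is parallel. -/
theorem antiPart_cov_Q (S : CVStructure V M) (X : VField V M) {U : Set M} (hU : IsOpen U)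
    (hX : SmoothOn X U) {Y : VField V M} (hY : SmoothOn Y U) {x : M} (hx : x ∈ U) :
    antiPart S.cov X (S.Q.app Y) x - S.Q x (antiPart S.cov X Y x)
      = -S.κ x (comm (S.mul.left X) (conjBy S.κ S.U) x (S.κ x (Y x))) := by
  have hκ := S.κ_smooth U hU Y hY
  have e1 : S.κ.app (S.κ.app Y) = Y := by ext y; exact S.κ_sq y _
  have e2 : S.Q.app Y = S.κ.app (-S.Q.app (S.κ.app Y)) := by
    ext y; simp [ConjField.app, EndoField.app, Q_κ, S.κ_sq]
  have h2 := S.antiPart_cov_κ X hU (S.Q_smooth U hU _ hκ).neg hx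
  have h3 := S.antiPart_cov_κ X hU hκ hx
  have h4 := S.holPart_cov_Q X hU hX hκ hx
  rw [e1] at h3
  rw [e2, h2, h3, holPart_cov_neg X (S.Q_smooth U hU _ hκ) hU hx, Q_κ, map_neg, ← neg_sub_neg,
    sub_eq_add_neg]
  have e3 : S.κ.app Y x = S.κ x (Y x) := rfl
  rw [← e3, ← h4, map_sub]
  abel

end CVStructure

end CovSubLie

/-! ### Derivatives of `𝒬` along the unit and the Euler field -/

section DerivativesOfQ

variable {V : Type*} [NormedAddCommGroup V] [NormedSpace ℂ V]
  {M : Type*} [TopologicalSpace M] [ChartedSpace V M] [IsManifold 𝓘(ℂ, V) ω M]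

namespace CVStructure

variable {S : CVStructure V M}

/-- `D_E - L_E - 𝒬` commutes with multiplication, so it is the `g`-symmetric part of `D_E - L_E`.
-/
theorem isSkewPartOfDiff_Q [FiniteDimensional ℂ V]
    (hsymm : ∀ (x : M) (X Y : TangentSpace 𝓘(ℂ, V) x), S.C x X Y = S.C x Y X)
    {e Eu : VField V M} (hE : S.IsUnitEuler e Eu) :
    IsSkewPartOfDiff S.g S.cov realLie Eu S.Q := by
  have := FiniteDimensional.complete ℂ V
  obtain ⟨A, hA⟩ := S.exists_isCovSubLie hE.2.1
  refine ⟨A, fun U hU Y hY x hx => ?_, fun x a b => ⟨S.Q_g x a b, ?_⟩⟩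
  · rw [hA.holPart_eq hU hY hx, sub_sub_cancel]
  · exact g_symm_of_map_mul hsymm hE (hA.euler_map_mul hsymm hE x) a b

theorem comm_left_unit {e Eu : VField V M} (hE : S.IsUnitEuler e Eu) (B : EndoField V M) (x : M)
    (v : TangentSpace 𝓘(ℂ, V) x) : comm (S.mul.left e) B x v = 0 := by
  simp [comm, ProdField.left, hE.mul_unit]

theorem comm_left_euler {e Eu : VField V M} (hE : S.IsUnitEuler e Eu) (B : EndoField V M) (x : M)
    (v : TangentSpace 𝓘(ℂ, V) x) : comm (S.mul.left Eu) B x v = comm S.U B x v := by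
  simp [comm, ProdField.left, hE.mul_euler]

/-- `κ [𝒰, κ 𝒰 κ] κ = -[𝒰, κ 𝒰 κ]`: this is why `D_E(𝒬)` and `D_Ē(𝒬)` coincide. -/
theorem κ_comm_κ (x : M) (v : TangentSpace 𝓘(ℂ, V) x) :
    -S.κ x (comm S.U (conjBy S.κ S.U) x (S.κ x v)) = comm S.U (conjBy S.κ S.U) x v := by
  simp [comm, conjBy, S.κ_sq]

theorem along_cov_unit_Q {e Eu : VField V M} (hE : S.IsUnitEuler e Eu) :
    (along S.cov e).EndoEq S.Q 0 := fun U hU Y hY x hx => by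
  have h := S.holPart_cov_Q e hU ((hE.1.mono (Set.subset_univ U)).smoothOn hU) hY hx
  rw [comm_left_unit hE] at h
  exact h

theorem alongBar_cov_unit_Q {e Eu : VField V M} (hE : S.IsUnitEuler e Eu) :
    (alongBar S.cov e).EndoEq S.Q 0 := fun U hU Y hY x hx => by
  have h := S.antiPart_cov_Q e hU ((hE.1.mono (Set.subset_univ U)).smoothOn hU) hY hx
  rw [comm_left_unit hE, map_zero, neg_zero] at h
  exact h

theorem along_cov_euler_Q {e Eu : VField V M} (hE : S.IsUnitEuler e Eu) :
    (along S.cov Eu).EndoEq S.Q (comm S.U (conjBy S.κ S.U)) := fun U hU Y hY x hx => by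
  have h := S.holPart_cov_Q Eu hU ((hE.2.1.mono (Set.subset_univ U)).smoothOn hU) hY hx
  rw [comm_left_euler hE] at h
  exact h

theorem alongBar_cov_euler_Q {e Eu : VField V M} (hE : S.IsUnitEuler e Eu) :
    (alongBar S.cov Eu).EndoEq S.Q (comm S.U (conjBy S.κ S.U)) := fun U hU Y hY x hx => by
  have h := S.antiPart_cov_Q Eu hU ((hE.2.1.mono (Set.subset_univ U)).smoothOn hU) hY hx
  rw [comm_left_euler hE, κ_comm_κ] at h
  exact h

/-- Along the conjugate of a holomorphic field, `L` and `D` agree. -/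
theorem alongBar_realLie_endoEq [FiniteDimensional ℂ V] {X : VField V M} (hX : HolOn X Set.univ)
    {B : EndoField V M} (h : (alongBar S.cov X).EndoEq S.Q B) :
    (alongBar realLie X).EndoEq S.Q B := fun U hU Y hY x hx => by
  obtain ⟨A, hA⟩ := S.exists_isCovSubLie hX
  have h1 := hA.antiPart_eq hU hY hx
  have h2 := hA.antiPart_eq hU (S.Q_smooth U hU Y hY) hx
  have h3 : antiPart S.cov X (S.Q.app Y) x - S.Q x (antiPart S.cov X Y x) = B x (Y x) :=
    h U hU Y hY x hx
  rw [← h1, ← h2] at h3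
  exact h3

/-! ### Lie derivatives of `h`, `g` and `κ` -/

/-- `L_X(h)(Y, Z) = h((D_X - L_X) Y, Z)`. -/
theorem IsCovSubLie.along_h {X : VField V M} {A : EndoField V M} (hA : S.IsCovSubLie X A)
    {U : Set M} (hU : IsOpen U) {Y Z : VField V M} (hY : SmoothOn Y U) (hZ : SmoothOn Z U)
    {x : M} (hx : x ∈ U) :
    (along realLie X).fn (S.h.app Y Z) x - S.h x ((along realLie X).vf Y x) (Z x)
      - S.h x (Y x) ((along realLie X).vfBar Z x) = S.h x (A x (Y x)) (Z x) := by
  have h1 : (along realLie X).fn (S.h.app Y Z) x = _ := S.along_fn_h X hU hY hZ hx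
  have h2 : (along realLie X).vf Y x = _ := hA.holPart_eq hU hY hx
  have h3 : (along realLie X).vfBar Z x = _ := hA.antiPart_eq hU hZ hx
  rw [h1, h2, h3, map_sub, LinearMap.sub_apply]
  ring

/-- `L_{X̄}(h)(Y, Z) = h(Y, (D_X - L_X) Z)`. -/
theorem IsCovSubLie.alongBar_h {X : VField V M} {A : EndoField V M} (hA : S.IsCovSubLie X A)
    {U : Set M} (hU : IsOpen U) {Y Z : VField V M} (hY : SmoothOn Y U) (hZ : SmoothOn Z U)
    {x : M} (hx : x ∈ U) :
    (alongBar realLie X).fn (S.h.app Y Z) x - S.h x ((alongBar realLie X).vf Y x) (Z x)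
      - S.h x (Y x) ((alongBar realLie X).vfBar Z x) = S.h x (Y x) (A x (Z x)) := by
  have h1 : (alongBar realLie X).fn (S.h.app Y Z) x = _ := S.alongBar_fn_h X hU hY hZ hx
  have h2 : (alongBar realLie X).vf Y x = _ := hA.antiPart_eq hU hY hx
  have h3 : (alongBar realLie X).vfBar Z x = _ := hA.holPart_eq hU hZ hx
  rw [h1, h2, h3, map_sub]
  ring

/-- `L_X(g)(Y, Z) = g((D_X - L_X) Y, Z) + g(Y, (D_X - L_X) Z)`. -/
theorem IsCovSubLie.along_g {X : VField V M} {A : EndoField V M} (hA : S.IsCovSubLie X A)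
    {U : Set M} (hU : IsOpen U) {Y Z : VField V M} (hY : SmoothOn Y U) (hZ : SmoothOn Z U)
    {x : M} (hx : x ∈ U) :
    (along realLie X).fn (S.g.app Y Z) x - S.g x ((along realLie X).vf Y x) (Z x)
      - S.g x (Y x) ((along realLie X).vf Z x)
      = S.g x (A x (Y x)) (Z x) + S.g x (Y x) (A x (Z x)) := by
  have h1 : (along realLie X).fn (S.g.app Y Z) x = _ := S.along_fn_g X hU hY hZ hx
  have h2 : (along realLie X).vf Y x = _ := hA.holPart_eq hU hY hx
  have h3 : (along realLie X).vf Z x = _ := hA.holPart_eq hU hZ hx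
  rw [h1, h2, h3, map_sub, map_sub, LinearMap.sub_apply]
  ring

/-- `L_X(κ) = -(D_X - L_X) κ`. -/
theorem IsCovSubLie.along_κ {X : VField V M} {A : EndoField V M} (hA : S.IsCovSubLie X A)
    {U : Set M} (hU : IsOpen U) {Y : VField V M} (hY : SmoothOn Y U) {x : M} (hx : x ∈ U) :
    (along realLie X).vf (S.κ.app Y) x - S.κ x ((along realLie X).vfBar Y x)
      = -A x (S.κ x (Y x)) := by
  have h2 : (along realLie X).vf (S.κ.app Y) x = _ := hA.holPart_eq hU (S.κ_smooth U hU Y hY) hx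
  have h3 : (along realLie X).vfBar Y x = _ := hA.antiPart_eq hU hY hx
  rw [h2, h3, S.holPart_cov_κ X hU hY hx, sub_sub_cancel_left]
  rfl

/-- `L_{X̄}(κ) = κ (D_X - L_X)`. -/
theorem IsCovSubLie.alongBar_κ {X : VField V M} {A : EndoField V M} (hA : S.IsCovSubLie X A)
    {U : Set M} (hU : IsOpen U) {Y : VField V M} (hY : SmoothOn Y U) {x : M} (hx : x ∈ U) :
    (alongBar realLie X).vf (S.κ.app Y) x - S.κ x ((alongBar realLie X).vfBar Y x)
      = S.κ x (A x (Y x)) := by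
  have h2 : (alongBar realLie X).vf (S.κ.app Y) x = _ :=
    hA.antiPart_eq hU (S.κ_smooth U hU Y hY) hx
  have h3 : (alongBar realLie X).vfBar Y x = _ := hA.holPart_eq hU hY hx
  rw [h2, h3, S.antiPart_cov_κ X hU hY hx, map_sub, sub_sub_cancel]

theorem IsCovSubLie.agreeOnFields_iff {X : VField V M} {A : EndoField V M}
    (hA : S.IsCovSubLie X A) : AgreeOnFields S.cov realLie X ↔ ∀ x v, A x v = 0 := by
  constructor
  · intro h x v
    obtain ⟨U, Y, hU, hx, hY, rfl⟩ := exists_holOn_apply_eq x v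
    have h1 := hA.holPart_eq hU (hY.smoothOn hU) hx
    rw [← h U hU Y (hY.smoothOn hU) x hx] at h1
    exact sub_eq_self.1 h1.symm
  · intro h U hU Y hY x hx
    rw [hA.holPart_eq hU hY hx, h, sub_zero]

theorem IsCovSubLie.sesqZero_along_iff {X : VField V M} {A : EndoField V M}
    (hA : S.IsCovSubLie X A) : (along realLie X).SesqZero S.h ↔ ∀ x v, A x v = 0 := by
  constructor
  · intro h x v
    refine (S.h_nondeg x).1 _ fun w => ?_
    obtain ⟨U, Y, hU, hx, hY, rfl⟩ := exists_holOn_apply_eq x v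
    obtain ⟨U', Z, hU', hx', hZ, rfl⟩ := exists_holOn_apply_eq x w
    have hY' := (hY.smoothOn hU).mono (U' := U ∩ U') Set.inter_subset_left
    have hZ' := (hZ.smoothOn hU').mono (U' := U ∩ U') Set.inter_subset_right
    rw [← hA.along_h (hU.inter hU') hY' hZ' ⟨hx, hx'⟩]
    exact h _ (hU.inter hU') Y Z hY' hZ' x ⟨hx, hx'⟩
  · intro h U hU Y Z hY hZ x hx
    rw [hA.along_h hU hY hZ hx, h, map_zero, LinearMap.zero_apply]

theorem IsCovSubLie.sesqZero_alongBar_iff {X : VField V M} {A : EndoField V M}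
    (hA : S.IsCovSubLie X A) : (alongBar realLie X).SesqZero S.h ↔ ∀ x v, A x v = 0 := by
  constructor
  · intro h x v
    refine (S.h_nondeg x).2 _ fun w => ?_
    obtain ⟨U, Y, hU, hx, hY, rfl⟩ := exists_holOn_apply_eq x w
    obtain ⟨U', Z, hU', hx', hZ, rfl⟩ := exists_holOn_apply_eq x v
    have hY' := (hY.smoothOn hU).mono (U' := U ∩ U') Set.inter_subset_left
    have hZ' := (hZ.smoothOn hU').mono (U' := U ∩ U') Set.inter_subset_right
    rw [← hA.alongBar_h (hU.inter hU') hY' hZ' ⟨hx, hx'⟩]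
    exact h _ (hU.inter hU') Y Z hY' hZ' x ⟨hx, hx'⟩
  · intro h U hU Y Z hY hZ x hx
    rw [hA.alongBar_h hU hY hZ hx, h, map_zero]

theorem IsCovSubLie.conjZero_along_iff {X : VField V M} {A : EndoField V M}
    (hA : S.IsCovSubLie X A) : (along realLie X).ConjZero S.κ ↔ ∀ x v, A x v = 0 := by
  constructor
  · intro h x v
    obtain ⟨U, Y, hU, hx, hY, hv⟩ := exists_holOn_apply_eq x (S.κ x v)
    have h1 := h U hU Y (hY.smoothOn hU) x hx
    rwa [hA.along_κ hU (hY.smoothOn hU) hx, hv, S.κ_sq, neg_eq_zero] at h1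
  · intro h U hU Y hY x hx
    rw [hA.along_κ hU hY hx, h, neg_zero]

theorem IsCovSubLie.conjZero_alongBar_iff {X : VField V M} {A : EndoField V M}
    (hA : S.IsCovSubLie X A) : (alongBar realLie X).ConjZero S.κ ↔ ∀ x v, A x v = 0 := by
  constructor
  · intro h x v
    obtain ⟨U, Y, hU, hx, hY, rfl⟩ := exists_holOn_apply_eq x v
    have h1 := h U hU Y (hY.smoothOn hU) x hx
    rw [hA.alongBar_κ hU (hY.smoothOn hU) hx] at h1
    rw [← S.κ_sq x (A x (Y x)), h1, map_zero]
  · intro h U hU Y hY x hx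
    rw [hA.alongBar_κ hU hY hx, h, map_zero]

/-- If a `g`-symmetric endomorphism field `B` differs from `D_X - L_X` by a `g`-skew-symmetric one,
then `L_X(g) = c g` means `B = c / 2`. -/
theorem IsCovSubLie.bilinEq_along_iff {X : VField V M} {A B : EndoField V M}
    (hA : S.IsCovSubLie X A) (hB : ∀ x a b, S.g x (B x a) b = S.g x a (B x b))
    (hAB : ∀ x a b, S.g x ((A x - B x) a) b = -S.g x a ((A x - B x) b)) (c : ℂ) :
    (along realLie X).BilinEq S.g c ↔ ∀ x v, B x v = (c / 2) • v := by
  have key : ∀ x a b, S.g x (A x a) b + S.g x a (A x b) = 2 * S.g x (B x a) b := by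
    intro x a b
    have h := hAB x a b
    simp only [LinearMap.sub_apply, map_sub] at h
    linear_combination h - hB x a b
  constructor
  · intro h x v
    rw [← sub_eq_zero]
    refine (S.g_nondeg x).1 _ fun w => ?_
    obtain ⟨U, Y, hU, hx, hY, rfl⟩ := exists_holOn_apply_eq x v
    obtain ⟨U', Z, hU', hx', hZ, rfl⟩ := exists_holOn_apply_eq x w
    have hY' := (hY.smoothOn hU).mono (U' := U ∩ U') Set.inter_subset_left
    have hZ' := (hZ.smoothOn hU').mono (U' := U ∩ U') Set.inter_subset_right
    have h1 := h _ (hU.inter hU') Y Z hY' hZ' x ⟨hx, hx'⟩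
    rw [hA.along_g (hU.inter hU') hY' hZ' ⟨hx, hx'⟩, key] at h1
    rw [map_sub, map_smul, LinearMap.sub_apply, LinearMap.smul_apply, smul_eq_mul]
    linear_combination h1 / 2
  · intro h U hU Y Z hY hZ x hx
    rw [hA.along_g hU hY hZ hx, key, h, map_smul, LinearMap.smul_apply, smul_eq_mul]
    ring

end CVStructure

end DerivativesOfQ

/-! ### Tensor fields and the conditions on the unit field -/

section UnitConditions

variable {V : Type*} [NormedAddCommGroup V] [NormedSpace ℂ V]
  {M : Type*} [TopologicalSpace M] [ChartedSpace V M]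

/-- A field of complex linear forms as a complex tensor field of order `(1, 0)`. -/
def formTensor (ℓ : (x : M) → TangentSpace 𝓘(ℂ, V) x →ₗ[ℂ] ℂ) : TensorField V M 1 0 := fun x =>
  MultilinearMap.ofSubsingleton ℝ (TangentSpace 𝓘(ℂ, V) x) _ (0 : Fin 1)
    ((MultilinearMap.constLinearEquivOfIsEmpty (R := ℝ) (S := ℝ) (ι := Fin 0)
      (M₁ := fun _ => TangentSpace 𝓘(ℂ, V) x →ₗ[ℝ] ℝ) (M₂ := ℂ)).toLinearMap ∘ₗ
      (ℓ x).restrictScalars ℝ)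

theorem formTensor_app (ℓ : (x : M) → TangentSpace 𝓘(ℂ, V) x →ₗ[ℂ] ℂ) (Y : Fin 1 → VField V M)
    (α : Fin 0 → CovField V M) (x : M) : (formTensor ℓ).app Y α x = ℓ x (Y 0 x) := rfl

variable [IsManifold 𝓘(ℂ, V) ω M]

theorem exists_smoothOn_localExt {x : M} (v : TangentSpace 𝓘(ℂ, V) x) :
    ∃ U : Set M, IsOpen U ∧ x ∈ U ∧ SmoothOn (localExt v) U := by
  obtain ⟨s, hs, hY⟩ := FiberBundle.exists_contMDiffOn_extend (k := ∞) 𝓘(ℝ, V) V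
    (V := fun y : M => TangentSpace 𝓘(ℝ, V) y) v
  obtain ⟨U, hUs, hU, hx⟩ := mem_nhds_iff.1 hs
  exact ⟨U, hU, hx, ContMDiffOn.mono hY hUs⟩

/-- The derivative of a tensor field along a real vector field only depends on the action of the
derivation on smooth vector fields. -/
theorem tensorDer_congr {δ δ' : VField V M → VField V M → VField V M} {X : VField V M}
    (h : ∀ U : Set M, IsOpen U → ∀ Y : VField V M, SmoothOn Y U → ∀ x ∈ U, δ X Y x = δ' X Y x)
    {k l : ℕ} (T : TensorField V M k l) {U : Set M} (hU : IsOpen U) {Y : Fin k → VField V M}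
    (α : Fin l → CovField V M) (hY : ∀ i, SmoothOn (Y i) U) {x : M} (hx : x ∈ U) :
    tensorDer δ X T Y α x = tensorDer δ' X T Y α x := by
  have hc : ∀ β : CovField V M, covDer δ X β x = covDer δ' X β x := by
    intro β
    have hf : covDerFun δ X β x = covDerFun δ' X β x := by
      ext v
      obtain ⟨U', hU', hx', hs⟩ := exists_smoothOn_localExt v
      simp only [covDerFun, h U' hU' _ hs x hx']
    unfold covDer
    rw [hf]
  simp only [tensorDer, TensorField.app]
  congr 1
  · congr 1
    refine Finset.sum_congr rfl fun i _ => ?_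
    congr 2
    funext j
    rcases eq_or_ne j i with rfl | hj
    · simp [h U hU _ (hY j) x hx]
    · simp [hj]
  · refine Finset.sum_congr rfl fun i _ => ?_
    congr 1
    funext j
    rcases eq_or_ne j i with rfl | hj
    · simp [hc]
    · simp [hj]

theorem tensorHolPart_formTensor (δ : VField V M → VField V M → VField V M) (X Y : VField V M)
    (ℓ : (x : M) → TangentSpace 𝓘(ℂ, V) x →ₗ[ℂ] ℂ) (x : M) :
    tensorHolPart δ X (formTensor ℓ) (fun _ => Y) Fin.elim0 x =
      (along δ X).fn (fun y => ℓ y (Y y)) x - ℓ x (holPart δ X Y x) := by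
  have e : (formTensor ℓ).app (fun _ => Y) Fin.elim0 = fun y => ℓ y (Y y) := rfl
  simp only [tensorHolPart, tensorDer, e, formTensor_app, along, holPart, Finset.univ_unique,
    Fin.default_eq_zero, Finset.sum_singleton, Finset.univ_eq_empty, Finset.sum_empty,
    Fin.isValue, Function.update_self, map_smul, map_sub, smul_eq_mul]
  ring

namespace CVStructure

variable {S : CVStructure V M}

/-- Evaluated on the forms `g(Z, ·)`, which are smooth tensor fields, agreement on tensor fields
forces `D_X - L_X = 0`. -/
theorem IsCovSubLie.agreeOnTensors_iff [FiniteDimensional ℂ V] {X : VField V M} {A : EndoField V M}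
    (hA : S.IsCovSubLie X A) : AgreeOnTensors S.cov realLie X ↔ ∀ x v, A x v = 0 := by
  constructor
  · intro h x v
    refine (S.g_nondeg x).1 _ fun w => ?_
    obtain ⟨U, Y, hU, hx, hY, rfl⟩ := exists_holOn_apply_eq x v
    obtain ⟨U', Z, hU', hx', hZ, rfl⟩ := exists_holOn_apply_eq x w
    have hY' := (hY.smoothOn hU).mono (U' := U ∩ U') Set.inter_subset_left
    have hZ' := (hZ.smoothOn hU').mono (U' := U ∩ U') Set.inter_subset_right
    have hT : (formTensor (fun y => S.g y (Z y))).IsSmoothOn (U ∩ U') := by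
      intro N hN hNo Y' α hY'' _
      have := smoothFunOn_bilin_app S.g_holo hNo (hZ'.mono hN) (hY'' 0)
      exact this
    have h1 := h 1 0 (U ∩ U') (hU.inter hU') _ hT (fun _ => Y) Fin.elim0 (fun _ => hY')
      (fun j => j.elim0) x ⟨hx, hx'⟩
    rw [tensorHolPart_formTensor, tensorHolPart_formTensor,
      hA.holPart_eq (hU.inter hU') hY' ⟨hx, hx'⟩, map_sub] at h1
    have h2 : (along S.cov X).fn (fun y => S.g y (Z y) (Y y)) x
      = (along realLie X).fn (fun y => S.g y (Z y) (Y y)) x := rfl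
    rw [S.g_symm]
    linear_combination h2 - h1
  · intro h k l U hU T _ Y α hY _ x hx
    have h1 : ∀ U : Set M, IsOpen U → ∀ Y : VField V M, SmoothOn Y U → ∀ x ∈ U,
        S.cov X Y x = realLie X Y x := fun U hU Y hY x hx => by
      rw [← sub_eq_zero, (hA U hU Y hY x hx).1, h]
    have h2 : ∀ U : Set M, IsOpen U → ∀ Y : VField V M, SmoothOn Y U → ∀ x ∈ U,
        S.cov (Complex.I • X) Y x = realLie (Complex.I • X) Y x := fun U hU Y hY x hx => by
      rw [← sub_eq_zero, (hA U hU Y hY x hx).2, h, smul_zero]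
    simp only [tensorHolPart]
    rw [tensorDer_congr h1 T hU α hY hx, tensorDer_congr h2 T hU α hY hx]

/-- `D_e - L_e` is multiplication by its value `D_e e` on the unit field. -/
theorem IsCovSubLie.cov_unit_iff [CompleteSpace V]
    (hsymm : ∀ (x : M) (X Y : TangentSpace 𝓘(ℂ, V) x), S.C x X Y = S.C x Y X)
    {e Eu : VField V M} (hE : S.IsUnitEuler e Eu) {A : EndoField V M} (hA : S.IsCovSubLie e A) :
    (∀ x : M, holPart S.cov e e x = 0) ↔ ∀ x v, A x v = 0 := by
  have h1 : ∀ x, A x (e x) = holPart S.cov e e x := fun x => by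
    have h := hA.holPart_eq isOpen_univ (hE.1.smoothOn isOpen_univ) (Set.mem_univ x)
    rw [holPart_realLie_of_holOn isOpen_univ hE.1 hE.1 (Set.mem_univ x)] at h
    have h0 : holBracket e e x = 0 := congrFun VectorField.mlieBracket_self x
    rw [h0] at h
    exact (sub_eq_zero.1 h.symm).symm
  constructor
  · intro h x v
    rw [eq_mul_apply_unit hsymm hE (hA.unit_map_mul hsymm hE x) v, h1, h, map_zero,
      LinearMap.zero_apply]
  · intro h x
    rw [← h1, h]

/-- Each of the conditions says that the endomorphism field `D_e - L_e` vanishes. -/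
theorem tfae_unit [FiniteDimensional ℂ V]
    (hsymm : ∀ (x : M) (X Y : TangentSpace 𝓘(ℂ, V) x), S.C x X Y = S.C x Y X)
    {e Eu : VField V M} (hE : S.IsUnitEuler e Eu) :
    List.TFAE
      [AgreeOnTensors S.cov realLie e,
       AgreeOnFields S.cov realLie e,
       ∀ x : M, holPart S.cov e e x = 0,
       (along realLie e).SesqZero S.h,
       (alongBar realLie e).SesqZero S.h,
       (along realLie e).ConjZero S.κ,
       (alongBar realLie e).ConjZero S.κ,
       (along realLie e).BilinEq S.g 0] := by
  have := FiniteDimensional.complete ℂ V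
  obtain ⟨A, hA⟩ := S.exists_isCovSubLie hE.1
  have h8 := hA.bilinEq_along_iff (B := A)
    (fun x => g_symm_of_map_mul hsymm hE (hA.unit_map_mul hsymm hE x)) (by simp) 0
  simp only [zero_div, zero_smul] at h8
  rw [hA.agreeOnTensors_iff, hA.agreeOnFields_iff, hA.cov_unit_iff hsymm hE,
    hA.sesqZero_along_iff, hA.sesqZero_alongBar_iff, hA.conjZero_along_iff,
    hA.conjZero_alongBar_iff, h8]
  simp

theorem along_realLie_unit_Q [FiniteDimensional ℂ V] {e Eu : VField V M}
    (hE : S.IsUnitEuler e Eu) (h : AgreeOnTensors S.cov realLie e) :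
    (along realLie e).EndoEq S.Q 0 := fun U hU Y hY x hx => by
  obtain ⟨A, hA⟩ := S.exists_isCovSubLie hE.1
  have h0 := hA.agreeOnFields_iff.2 (hA.agreeOnTensors_iff.1 h)
  have h1 : holPart S.cov e (S.Q.app Y) x - S.Q x (holPart S.cov e Y x) = 0 :=
    along_cov_unit_Q hE U hU Y hY x hx
  rw [h0 U hU _ (S.Q_smooth U hU Y hY) x hx, h0 U hU Y hY x hx] at h1
  exact h1

/-! ### Homogeneity along the Euler field -/

/-- If `L_E(g) = (2 - d) g`, then `D_E - L_E = 𝒬 + (2 - d) / 2`. -/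
theorem IsCovSubLie.euler_eq [CompleteSpace V]
    (hsymm : ∀ (x : M) (X Y : TangentSpace 𝓘(ℂ, V) x), S.C x X Y = S.C x Y X)
    {e Eu : VField V M} (hE : S.IsUnitEuler e Eu) {A : EndoField V M} (hA : S.IsCovSubLie Eu A)
    {d : ℝ} (hd : (along realLie Eu).BilinEq S.g (2 - d)) (x : M) (v : TangentSpace 𝓘(ℂ, V) x) :
    A x v = S.Q x v + ((2 - d) / 2 : ℂ) • v := by
  have h := (hA.bilinEq_along_iff (B := fun x => A x - S.Q x)
    (fun x => g_symm_of_map_mul hsymm hE (hA.euler_map_mul hsymm hE x))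
    (fun x a b => by simpa using S.Q_g x a b) (2 - d)).1 hd x v
  rw [← h, LinearMap.sub_apply, add_sub_cancel]

/-- `𝒬` is `h`-selfadjoint, and so is a real multiple of the identity. -/
theorem h_euler_symm {A : EndoField V M} {d : ℝ}
    (hA : ∀ x v, A x v = S.Q x v + ((2 - d) / 2 : ℂ) • v) (x : M)
    (v w : TangentSpace 𝓘(ℂ, V) x) : S.h x (A x v) w = S.h x v (A x w) := by
  simp only [hA, map_add, map_smul, LinearMap.add_apply, LinearMap.smul_apply,
    LinearMap.map_smulₛₗ, S.Q_h, map_div₀, map_sub, map_ofNat, Complex.conj_ofReal]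

theorem sesqZero_euler_sub [CompleteSpace V] {Eu : VField V M} {A : EndoField V M}
    (hA : S.IsCovSubLie Eu A) (hs : ∀ x v w, S.h x (A x v) w = S.h x v (A x w)) :
    ((along realLie Eu).sub (alongBar realLie Eu)).SesqZero S.h := fun U hU Y Z hY hZ x hx => by
  have h1 := hA.along_h hU hY hZ hx
  have h2 := hA.alongBar_h hU hY hZ hx
  have h3 := hs x (Y x) (Z x)
  change ((along realLie Eu).fn (S.h.app Y Z) x - (alongBar realLie Eu).fn (S.h.app Y Z) x)
    - S.h x ((along realLie Eu).vf Y x - (alongBar realLie Eu).vf Y x) (Z x)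
    - S.h x (Y x) ((along realLie Eu).vfBar Z x - (alongBar realLie Eu).vfBar Z x) = 0
  simp only [map_sub, LinearMap.sub_apply]
  linear_combination h1 - h2 + h3

/-- `D_E - L_E` commutes with `𝒬`, hence `L_E(𝒬) = D_E(𝒬)`. -/
theorem along_realLie_euler_Q [FiniteDimensional ℂ V] {e Eu : VField V M}
    (hE : S.IsUnitEuler e Eu) {A : EndoField V M} (hA : S.IsCovSubLie Eu A) {c : ℂ}
    (hAQ : ∀ x v, A x v = S.Q x v + c • v) :
    (along realLie Eu).EndoEq S.Q (comm S.U (conjBy S.κ S.U)) := fun U hU Y hY x hx => by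
  have h1 : holPart S.cov Eu (S.Q.app Y) x - S.Q x (holPart S.cov Eu Y x) = _ :=
    along_cov_euler_Q hE U hU Y hY x hx
  have h2 : (along realLie Eu).vf (S.Q.app Y) x = _ :=
    hA.holPart_eq hU (S.Q_smooth U hU Y hY) hx
  have h3 : (along realLie Eu).vf Y x = _ := hA.holPart_eq hU hY hx
  have e1 : S.Q.app Y x = S.Q x (Y x) := rfl
  rw [h2, h3, ← h1, hAQ, hAQ, e1, map_sub, map_add, map_smul]
  abel

theorem sub_endoEq_zero {a b : DirDer V M} {B : EndoField V M} (ha : a.EndoEq S.Q B)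
    (hb : b.EndoEq S.Q B) : (a.sub b).EndoEq S.Q 0 := fun U hU Y hY x hx => by
  have h1 := ha U hU Y hY x hx
  have h2 := hb U hU Y hY x hx
  change a.vf (S.Q.app Y) x - b.vf (S.Q.app Y) x - S.Q x (a.vf Y x - b.vf Y x) = 0
  rw [map_sub, ← sub_eq_zero.2 (h1.trans h2.symm)]
  abel

end CVStructure

end UnitConditions

/-! ### The variational equation of a flow -/

section VariationalEquation

/-- If `∂ₜ G(t, y) = Z(G(t, y))`, then the derivative of `G` in the second variable solves the
linearized equation, because second derivatives commute. -/
theorem hasDerivAt_fderiv_of_flow {V : Type*} [NormedAddCommGroup V] [NormedSpace ℝ V]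
    {G : ℝ × V → V} {Z : V → V} {t₀ : ℝ} {y₀ : V} (hG : ContDiffAt ℝ 2 G (t₀, y₀))
    (hZ : DifferentiableAt ℝ Z (G (t₀, y₀)))
    (hflow : ∀ᶠ z in 𝓝 (t₀, y₀), fderiv ℝ G z (1, 0) = Z (G z)) (v : V) :
    HasDerivAt (fun t => fderiv ℝ G (t, y₀) (0, v))
      (fderiv ℝ Z (G (t₀, y₀)) (fderiv ℝ G (t₀, y₀) (0, v))) t₀ := by
  have hd : DifferentiableAt ℝ (fderiv ℝ G) (t₀, y₀) :=
    (hG.fderiv_right (m := 1) (by norm_num)).differentiableAt (by simp)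
  have hsymm : IsSymmSndFDerivAt ℝ G (t₀, y₀) := hG.isSymmSndFDerivAt (by simp)
  have hline : HasDerivAt (fun t : ℝ => ((t, y₀) : ℝ × V)) ((1 : ℝ), (0 : V)) t₀ :=
    (hasDerivAt_id t₀).prodMk (hasDerivAt_const t₀ y₀)
  have h1 : HasDerivAt (fun t => fderiv ℝ G (t, y₀) (0, v))
      (fderiv ℝ (fderiv ℝ G) (t₀, y₀) (1, 0) (0, v)) t₀ := by
    have h := (hd.hasFDerivAt.comp_hasDerivAt t₀ hline)
    exact h.clm_apply (hasDerivAt_const t₀ ((0 : ℝ), v)) |>.congr_deriv (by simp)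
  refine h1.congr_deriv ?_
  rw [hsymm.eq]
  have h2 : HasFDerivAt (fun z => fderiv ℝ G z (1, 0))
      ((fderiv ℝ (fderiv ℝ G) (t₀, y₀)).flip (1, 0)) (t₀, y₀) := by
    have h := hd.hasFDerivAt.clm_apply (hasFDerivAt_const ((1 : ℝ), (0 : V)) (t₀, y₀))
    exact h.congr_fderiv (by ext <;> simp)
  have h3 : HasFDerivAt (fun z => Z (G z))
      ((fderiv ℝ Z (G (t₀, y₀))).comp (fderiv ℝ G (t₀, y₀))) (t₀, y₀) :=
    hZ.hasFDerivAt.comp (t₀, y₀) (hG.differentiableAt (by simp)).hasFDerivAt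
  have h4 := (h3.congr_of_eventuallyEq hflow).unique h2
  have h5 := congrArg (fun A : ℝ × V →L[ℝ] V => A (0, v)) h4
  exact h5.symm

variable {V : Type*} [NormedAddCommGroup V] [NormedSpace ℂ V]
  {M : Type*} [TopologicalSpace M] [ChartedSpace V M]

namespace IsLocalFlow

variable {Z : VField V M} {W : Set (ℝ × M)} {φ : ℝ × M → M}

theorem contMDiffAt (hφ : IsLocalFlow Z W φ) {t : ℝ} {x : M} (h : (t, x) ∈ W) :
    ContMDiffAt (𝓘(ℝ, ℝ).prod 𝓘(ℝ, V)) 𝓘(ℝ, V) ∞ φ (t, x) :=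
  hφ.smooth.contMDiffAt (hφ.isOpen.mem_nhds h)

theorem hasMFDerivAt_curve (hφ : IsLocalFlow Z W φ) {t : ℝ} {x : M} (h : (t, x) ∈ W) :
    HasMFDerivAt 𝓘(ℝ, ℝ) 𝓘(ℝ, V) (fun s => φ (s, x)) t
      ((1 : ℝ →L[ℝ] ℝ).smulRight (Z (φ (t, x)) : V)) := by
  have ho : IsOpen {s : ℝ | (s, x) ∈ W} :=
    hφ.isOpen.preimage (Continuous.prodMk continuous_id continuous_const)
  exact (hφ.curve x t h).hasMFDerivAt (ho.mem_nhds h)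

theorem mdifferentiableAt_slice (hφ : IsLocalFlow Z W φ) {t : ℝ} {x : M} (h : (t, x) ∈ W) :
    MDifferentiableAt 𝓘(ℝ, V) 𝓘(ℝ, V) (fun y => φ (t, y)) x := by
  have h1 : ContMDiffAt 𝓘(ℝ, V) (𝓘(ℝ, ℝ).prod 𝓘(ℝ, V)) ∞ (fun y : M => (t, y)) x :=
    contMDiffAt_const.prodMk contMDiffAt_id
  exact ((hφ.contMDiffAt h).comp x h1).mdifferentiableAt (by simp)

theorem eventually_mem (hφ : IsLocalFlow Z W φ) {t : ℝ} {x : M} (h : (t, x) ∈ W) :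
    ∀ᶠ q in 𝓝 (t, x), q ∈ W ∧ φ q ∈ (chartAt V (φ (t, x))).source :=
  Filter.Eventually.and (hφ.isOpen.mem_nhds h)
    ((hφ.contMDiffAt h).continuousAt.eventually
      ((chartAt V (φ (t, x))).open_source.mem_nhds (mem_chart_source V _)))

end IsLocalFlow

variable [IsManifold 𝓘(ℂ, V) ω M]

theorem coordAt_eq_mfderiv (p : M) {x : M} (hx : x ∈ (chartAt V p).source)
    (v : V) : (coordAt p x : V →L[ℂ] V) v =
    (mfderiv 𝓘(ℝ, V) 𝓘(ℝ, V) (extChartAt 𝓘(ℝ, V) p) x : V →L[ℝ] V) v :=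
  (coordAt_apply p hx v).trans ((trivializationAt_real_eq p hx v).symm.trans
    (trivializationAt_tangent_eq_mfderiv p hx v))

theorem coordAt_self (p : M) (v : V) : (coordAt p p : V →L[ℂ] V) v = v := by
  rw [coordAt_eq_mfderiv p (mem_chart_source V p), mfderiv_extChartAt_self]
  rfl

theorem constField_self (p : M) (v : V) : (constField p v p : V) = v := by
  have h := coordAt_constField p (mem_chart_source V p) v
  exact (coordAt_self (V := V) (M := M) p (constField p v p : V)).symm.trans h

/-- At the base point of the chart the bracket of `Z` with a constant field is minus the
linearization of `Z`. -/
theorem realLie_constField (Z : VField V M) (p : M) (v : V) :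
    (realLie Z (constField p v) p : V) =
      -fderiv ℝ (coordField ℝ p Z) (extChartAt 𝓘(ℝ, V) p p) v := by
  have h1 := mlieBracket_eq_coordField (𝕜 := ℝ) (E := V) (N := M) Z (constField p v) p
  have h2 : coordField ℝ p (E := V) (N := M) (constField p v)
      =ᶠ[𝓝 (extChartAt 𝓘(ℝ, V) p p)] fun _ => v := by
    filter_upwards [extChartAt_target_mem_nhds (I := 𝓘(ℝ, V)) p] with y hy
    have hs := (extChartAt 𝓘(ℝ, V) p).map_target hy
    rw [extChartAt_source] at hs
    have h3 := coordField_extChartAt (𝕜 := ℝ) (E := V) (N := M) p (constField p v) hs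
    rw [(extChartAt 𝓘(ℝ, V) p).right_inv hy] at h3
    rw [h3]
    exact (coordAt_eq_mfderiv p hs _).symm.trans (coordAt_constField p hs v)
  rw [h2.fderiv_eq, h2.eq_of_nhds] at h1
  have key : ∀ y w u : V, fderiv ℝ (fun _ : V => v) y w - u = -u := by intros; simp
  exact h1.trans (key _ _ _)

namespace IsLocalFlow

variable {Z : VField V M} {W : Set (ℝ × M)} {φ : ℝ × M → M}

/-- The flow near `x`, written in the chart at `x` in the source and the chart at `p` in the
target. -/
def chartFlow (φ : ℝ × M → M) (x p : M) : ℝ × V → V := fun z =>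
  extChartAt 𝓘(ℝ, V) p (φ (z.1, (extChartAt 𝓘(ℝ, V) x).symm z.2))

theorem contDiffAt_chartFlow (hφ : IsLocalFlow Z W φ) {t : ℝ} {x : M} (h : (t, x) ∈ W) :
    ContDiffAt ℝ ∞ (chartFlow φ x (φ (t, x))) (t, extChartAt 𝓘(ℝ, V) x x) := by
  rw [← contMDiffAt_iff_contDiffAt]
  have h1 : ContMDiffAt 𝓘(ℝ, V) 𝓘(ℝ, V) ∞ (extChartAt 𝓘(ℝ, V) x).symm
      (extChartAt 𝓘(ℝ, V) x x) :=
    (contMDiffOn_extChartAt_symm x).contMDiffAt (extChartAt_target_mem_nhds x)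
  have h2 : ContMDiffAt 𝓘(ℝ, ℝ × V) (𝓘(ℝ, ℝ).prod 𝓘(ℝ, V)) ∞
      (fun z : ℝ × V => (z.1, (extChartAt 𝓘(ℝ, V) x).symm z.2)) (t, extChartAt 𝓘(ℝ, V) x x) :=
    contDiff_fst.contMDiff.contMDiffAt.prodMk
      (ContMDiffAt.comp (t, extChartAt 𝓘(ℝ, V) x x) h1 contDiff_snd.contMDiff.contMDiffAt)
  have e : (extChartAt 𝓘(ℝ, V) x).symm (extChartAt 𝓘(ℝ, V) x x) = x := extChartAt_to_inv x
  have h3 : ContMDiffAt (𝓘(ℝ, ℝ).prod 𝓘(ℝ, V)) 𝓘(ℝ, V) ∞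
      (fun q => extChartAt 𝓘(ℝ, V) (φ (t, x)) (φ q))
      (t, (extChartAt 𝓘(ℝ, V) x).symm (extChartAt 𝓘(ℝ, V) x x)) := by
    rw [e]
    exact ContMDiffAt.comp (t, x) contMDiffAt_extChartAt (hφ.contMDiffAt h)
  exact ContMDiffAt.comp (g := fun q => extChartAt 𝓘(ℝ, V) (φ (t, x)) (φ q))
    (f := fun z : ℝ × V => (z.1, (extChartAt 𝓘(ℝ, V) x).symm z.2)) _ h3 h2

/-- The flow in charts satisfies the differential equation of the field in the chart. -/
theorem eventually_fderiv_chartFlow (hφ : IsLocalFlow Z W φ) {t : ℝ} {x : M} (h : (t, x) ∈ W) :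
    ∀ᶠ z in 𝓝 (t, extChartAt 𝓘(ℝ, V) x x),
      fderiv ℝ (chartFlow φ x (φ (t, x))) z (1, 0)
        = coordField ℝ (φ (t, x)) (N := M) Z (chartFlow φ x (φ (t, x)) z) := by
  have hG := ((hφ.contDiffAt_chartFlow h).of_le (m := 1) (by simp)).eventually (by simp)
  have e : (extChartAt 𝓘(ℝ, V) x).symm (extChartAt 𝓘(ℝ, V) x x) = x := extChartAt_to_inv x
  have hc : ContinuousAt (fun z : ℝ × V => (z.1, (extChartAt 𝓘(ℝ, V) x).symm z.2))
      (t, extChartAt 𝓘(ℝ, V) x x) :=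
    continuousAt_fst.prodMk
      (ContinuousAt.comp (x := (t, extChartAt 𝓘(ℝ, V) x x)) (continuousAt_extChartAt_symm x)
        continuousAt_snd)
  have hm := hc.eventually (p := fun q => q ∈ W ∧ φ q ∈ (chartAt V (φ (t, x))).source)
    (by simpa only [e] using hφ.eventually_mem h)
  filter_upwards [hG, hm] with z hz hz'
  set q := (extChartAt 𝓘(ℝ, V) x).symm z.2 with hq
  have hline : HasDerivAt (fun s : ℝ => ((s, z.2) : ℝ × V)) ((1 : ℝ), (0 : V)) z.1 :=
    (hasDerivAt_id z.1).prodMk (hasDerivAt_const z.1 z.2)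
  have h1 := (hz.differentiableAt (by simp)).hasFDerivAt.comp_hasDerivAt z.1 hline
  have h2 := hφ.hasMFDerivAt_curve hz'.1
  have h3 : MDifferentiableAt 𝓘(ℝ, V) 𝓘(ℝ, V) (extChartAt 𝓘(ℝ, V) (φ (t, x))) (φ (z.1, q)) :=
    mdifferentiableAt_extChartAt hz'.2
  let A : V →L[ℝ] V := mfderiv 𝓘(ℝ, V) 𝓘(ℝ, V) (extChartAt 𝓘(ℝ, V) (φ (t, x))) (φ (z.1, q))
  let w : V := Z (φ (z.1, q))
  have h4 : HasFDerivAt (fun s => extChartAt 𝓘(ℝ, V) (φ (t, x)) (φ (s, q)))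
      (A.comp ((1 : ℝ →L[ℝ] ℝ).smulRight w)) z.1 :=
    hasMFDerivAt_iff_hasFDerivAt.1 (HasMFDerivAt.comp z.1 h3.hasMFDerivAt h2)
  have h5 := h1.unique h4.hasDerivAt
  refine h5.trans ?_
  have h6 := coordField_extChartAt (𝕜 := ℝ) (E := V) (N := M) (φ (t, x)) Z hz'.2
  refine Eq.trans ?_ h6.symm
  refine congrArg (mfderiv 𝓘(ℝ, V) 𝓘(ℝ, V) (extChartAt 𝓘(ℝ, V) (φ (t, x))) (φ (z.1, q)) :
    V →L[ℝ] V) ?_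
  exact one_smul ℝ _

/-- The coordinates of `dφ_s v` are the derivative of the flow in the charts. -/
theorem coordAt_flowDeriv (hφ : IsLocalFlow Z W φ) {t : ℝ} {x : M} (h : (t, x) ∈ W) (v : V) :
    ∀ᶠ s in 𝓝 t, (coordAt (φ (t, x)) (φ (s, x)) (flowDeriv φ s x v) : V)
      = fderiv ℝ (chartFlow φ x (φ (t, x))) (s, extChartAt 𝓘(ℝ, V) x x) (0, v) := by
  have hG := ((hφ.contDiffAt_chartFlow h).of_le (m := 1) (by simp)).eventually (by simp)
  have c1 : ContinuousAt (fun s : ℝ => (s, extChartAt 𝓘(ℝ, V) x x)) t := by fun_prop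
  have c2 : ContinuousAt (fun s : ℝ => (s, x)) t := by fun_prop
  filter_upwards [c1.eventually hG, c2.eventually (hφ.eventually_mem h)] with s hs hs'
  have h3 : MDifferentiableAt 𝓘(ℝ, V) 𝓘(ℝ, V) (extChartAt 𝓘(ℝ, V) (φ (t, x))) (φ (s, x)) :=
    mdifferentiableAt_extChartAt hs'.2
  have h1 := HasMFDerivAt.comp x h3.hasMFDerivAt (hφ.mdifferentiableAt_slice hs'.1).hasMFDerivAt
  let A : V →L[ℝ] V := mfderiv 𝓘(ℝ, V) 𝓘(ℝ, V) (extChartAt 𝓘(ℝ, V) (φ (t, x))) (φ (s, x))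
  let B : V →L[ℝ] V := mfderiv 𝓘(ℝ, V) 𝓘(ℝ, V) (fun y => φ (s, y)) x
  have h2 : HasFDerivWithinAt (E := V) (F := V) (fun y => chartFlow φ x (φ (t, x)) (s, y))
      (A.comp B) (Set.range 𝓘(ℝ, V)) (extChartAt 𝓘(ℝ, V) x x) := h1.2
  rw [show Set.range 𝓘(ℝ, V) = Set.univ by simp, hasFDerivWithinAt_univ] at h2
  have hline : HasFDerivAt (fun y : V => ((s, y) : ℝ × V)) (ContinuousLinearMap.inr ℝ ℝ V)
      (extChartAt 𝓘(ℝ, V) x x) := hasFDerivAt_prodMk_right s _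
  have h5 := (hs.differentiableAt (by simp)).hasFDerivAt.comp (extChartAt 𝓘(ℝ, V) x x) hline
  have h6 := congrArg (fun A : V →L[ℝ] V => A v) (h2.unique h5)
  refine (coordAt_eq_mfderiv _ hs'.2 _).trans (Eq.trans h6 ?_)
  simp

/-- The variational equation: in the chart at `φ(t, x)` the vector `dφ_s v` solves the
linearization of the equation of the flow. -/
theorem hasDerivAt_coordAt_flowDeriv [CompleteSpace V] (hφ : IsLocalFlow Z W φ)
    (hZ : SmoothOn Z Set.univ) {t : ℝ} {x : M} (h : (t, x) ∈ W) (v : V) :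
    HasDerivAt (fun s => (coordAt (φ (t, x)) (φ (s, x)) (flowDeriv φ s x v) : V))
      (fderiv ℝ (coordField ℝ (φ (t, x)) (N := M) Z) (extChartAt 𝓘(ℝ, V) (φ (t, x)) (φ (t, x)))
        (flowDeriv φ t x v : V)) t := by
  have hev := hφ.coordAt_flowDeriv h v
  have h0 := hev.self_of_nhds
  have e : chartFlow φ x (φ (t, x)) (t, extChartAt 𝓘(ℝ, V) x x)
      = extChartAt 𝓘(ℝ, V) (φ (t, x)) (φ (t, x)) := by
    simp only [chartFlow]
    rw [extChartAt_to_inv x]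
  have hd : DifferentiableAt ℝ (coordField ℝ (φ (t, x)) (N := M) Z)
      (extChartAt 𝓘(ℝ, V) (φ (t, x)) (φ (t, x))) :=
    differentiableAt_coordField (𝕜 := ℝ) (E := V) (N := M)
      (hZ.mdifferentiableAt isOpen_univ (Set.mem_univ _))
  have h1 := hasDerivAt_fderiv_of_flow ((hφ.contDiffAt_chartFlow h).of_le 
    (mod_cast le_top : ((2 : ℕ∞) : WithTop ℕ∞) ≤ ∞))
    (by rw [e]; exact hd) (hφ.eventually_fderiv_chartFlow h) v
  rw [e, ← h0] at h1
  have h2 := h1.congr_of_eventuallyEq hev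
  refine h2.congr_deriv (congrArg _ ?_)
  exact coordAt_self _ _

end IsLocalFlow

end VariationalEquation

/-! ### Invariance of sesquilinear forms under flows -/

section InvariantForms

/-- Product rule for a family of bilinear forms evaluated on two curves. -/
theorem hasDerivAt_bilin_apply {V : Type*} [NormedAddCommGroup V] [NormedSpace ℝ V]
    [FiniteDimensional ℝ V] {β : ℝ → V →ₗ[ℝ] V →ₗ[ℝ] ℂ} {β' : V →ₗ[ℝ] V →ₗ[ℝ] ℂ} {ξ η : ℝ → V}
    {ξ' η' : V} {t : ℝ} (hβ : ∀ v w, HasDerivAt (fun s => β s v w) (β' v w) t)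
    (hξ : HasDerivAt ξ ξ' t) (hη : HasDerivAt η η' t) :
    HasDerivAt (fun s => β s (ξ s) (η s))
      (β t ξ' (η t) + β t (ξ t) η' + β' (ξ t) (η t)) t := by
  -- In a basis the value is a sum of products of real functions with the entries of `β`.
  let c := Module.finBasis ℝ V
  have key : ∀ (B : V →ₗ[ℝ] V →ₗ[ℝ] ℂ) (v w : V),
      B v w = ∑ i, ∑ j, c.repr v i • c.repr w j • B (c i) (c j) := fun B v w => by
    conv_lhs => rw [← c.sum_repr v, ← c.sum_repr w]
    simp only [map_sum, map_smul, LinearMap.sum_apply, LinearMap.smul_apply, Finset.smul_sum]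
    rw [Finset.sum_comm]
    simp only [smul_smul, mul_comm]
  have hr : ∀ (i) {ζ : ℝ → V} {ζ' : V}, HasDerivAt ζ ζ' t →
      HasDerivAt (fun s => c.repr (ζ s) i) (c.repr ζ' i) t := fun i ζ ζ' h =>
    (c.coord i).toContinuousLinearMap.hasFDerivAt.comp_hasDerivAt t h
  have h := HasDerivAt.fun_sum (u := Finset.univ) fun i _ =>
    HasDerivAt.fun_sum (u := Finset.univ) fun j _ =>
      (hr i hξ).fun_smul ((hr j hη).fun_smul (hβ (c i) (c j)))
  rw [funext fun s => key (β s) (ξ s) (η s), key (β t) ξ', key (β t) _ η', key β']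
  refine h.congr_deriv ?_
  simp only [← Finset.sum_add_distrib]
  refine Finset.sum_congr rfl fun i _ => Finset.sum_congr rfl fun j _ => ?_
  simp only [smul_add]
  abel

variable {V : Type*} [NormedAddCommGroup V] [NormedSpace ℂ V]
  {M : Type*} [TopologicalSpace M] [ChartedSpace V M]

namespace IsLocalFlow

variable {Z : VField V M} {W : Set (ℝ × M)} {φ : ℝ × M → M}

theorem sesq_flowDeriv_zero (hφ : IsLocalFlow Z W φ) (b : SesqField V M) {x : M}
    (h : ((0 : ℝ), x) ∈ W) (v w : TangentSpace 𝓘(ℂ, V) x) :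
    b (φ (0, x)) (flowDeriv φ 0 x v) (flowDeriv φ 0 x w) = b x v w := by
  have h1 : (fun y => φ (0, y)) =ᶠ[𝓝 x] id := by
    have ho : IsOpen {y : M | ((0 : ℝ), y) ∈ W} := hφ.isOpen.preimage (by fun_prop)
    filter_upwards [ho.mem_nhds h] with y hy using hφ.init y hy
  have h2 : HasMFDerivAt 𝓘(ℝ, V) 𝓘(ℝ, V) (fun y => φ (0, y)) x (ContinuousLinearMap.id ℝ V) :=
    (hasMFDerivAt_id x).congr_of_eventuallyEq h1
  have h3 : ∀ u : V, (flowDeriv φ 0 x u : V) = u := fun u =>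
    congrArg (fun A : V →L[ℝ] V => A u) h2.mfderiv
  let F : M → V → V → ℂ := fun y a c => b y a c
  have h4 : F (φ (0, x)) v w = F x v w := by rw [hφ.init x h]
  exact (congrArg₂ (F (φ (0, x))) (h3 v) (h3 w)).trans h4

variable [IsManifold 𝓘(ℂ, V) ω M]

/-- If the Lie derivative of the sesquilinear form `b` along `Z` vanishes, then `b(dφ_s v, dφ_s w)`
has derivative `0`. At time `t` the vectors `dφ_s v` are expressed by fields which are constant in
the chart at `φ_t x`. Their coordinates change by the linearization of `Z`, and so do, with the
opposite sign, the values of `b` on the constant fields. -/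
theorem hasDerivAt_sesq_flowDeriv [FiniteDimensional ℂ V] (hφ : IsLocalFlow Z W φ)
    (hZ : SmoothOn Z Set.univ) {b : SesqField V M}
    (hb : ∀ U : Set M, IsOpen U → ∀ Y Y' : VField V M, SmoothOn Y U → SmoothOn Y' U → ∀ x ∈ U,
      MDifferentiableAt 𝓘(ℝ, V) 𝓘(ℝ, ℂ) (b.app Y Y') x ∧
      realDer Z (b.app Y Y') x = b x (realLie Z Y x) (Y' x) + b x (Y x) (realLie Z Y' x))
    {t : ℝ} {x : M} (h : (t, x) ∈ W) (v w : TangentSpace 𝓘(ℂ, V) x) :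
    HasDerivAt (fun s => b (φ (s, x)) (flowDeriv φ s x v) (flowDeriv φ s x w)) 0 t := by
  have := FiniteDimensional.complete ℂ V
  set p := φ (t, x) with hp
  have hsm : ∀ (y : M) (r : ℝ) (u : V),
      constField p (r • u) y = (r : ℂ) • constField p u y := fun y r u => by
    rw [← constField_smul]; rfl
  -- `b` in the chart at `p`, as a family of real bilinear forms on `V`
  let β : M → V →ₗ[ℝ] V →ₗ[ℝ] ℂ := fun y => LinearMap.mk₂ ℝ
    (fun u u' => b y (constField p u y) (constField p u' y))
    (fun u₁ u₂ u' => by simp [constField_add]) (fun r u u' => by simp [hsm])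
    (fun u u₁ u₂ => by simp [constField_add]) (fun r u u' => by
      rw [hsm, LinearMap.map_smulₛₗ, Complex.conj_ofReal]; rfl)
  -- the linearization of `Z` at `p`
  let Λ : V →L[ℝ] V := fderiv ℝ (coordField ℝ p (N := M) Z) (extChartAt 𝓘(ℝ, V) p p)
  have hβp : ∀ u u' : V, β p u u' = b p u u' := fun u u' =>
    congrArg₂ (fun a a' : V => b p a a') (constField_self p u) (constField_self p u')
  have hβ : ∀ u u' : V, HasDerivAt (fun s => β (φ (s, x)) u u')
      ((-(β p).compl₁₂ Λ.toLinearMap LinearMap.id - (β p).compl₁₂ LinearMap.id Λ.toLinearMap :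
        V →ₗ[ℝ] V →ₗ[ℝ] ℂ) u u') t := fun u u' => by
    have ho := (chartAt V p).open_source
    have hs := fun u => (constField_holOn p u).smoothOn ho
    obtain ⟨h1, h2⟩ := hb _ ho _ _ (hs u) (hs u') p (mem_chart_source V p)
    let L : V →L[ℝ] ℂ := mfderiv 𝓘(ℝ, V) 𝓘(ℝ, ℂ) (b.app (constField p u) (constField p u')) p
    let z : V := Z p
    have h3 : HasFDerivAt (fun s => β (φ (s, x)) u u')
        (L.comp ((1 : ℝ →L[ℝ] ℝ).smulRight z)) t :=
      hasMFDerivAt_iff_hasFDerivAt.1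
        (HasMFDerivAt.comp t h1.hasMFDerivAt (hφ.hasMFDerivAt_curve h))
    refine h3.hasDerivAt.congr_deriv ?_
    have h4 : L z = _ := h2
    have h5 : L.comp ((1 : ℝ →L[ℝ] ℝ).smulRight z) 1 = L z := by simp
    refine h5.trans (h4.trans ?_)
    have h6 : ∀ a c : V, b p a (constField p u' p) + b p (constField p u p) c
        = β p a u' + β p u c := fun a c =>
      congrArg₂ (· + ·) ((congrArg (fun d : V => b p a d) (constField_self p u')).trans
        (hβp a u').symm) ((congrArg (fun d : V => b p d c) (constField_self p u)).trans
        (hβp u c).symm)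
    refine (h6 _ _).trans ?_
    refine (congrArg₂ (fun a c : V => β p a u' + β p u c) (realLie_constField Z p u)
      (realLie_constField Z p u')).trans ?_
    change β p (-Λ u) u' + β p u (-Λ u') = -β p (Λ u) u' - β p u (Λ u')
    rw [map_neg, map_neg, LinearMap.neg_apply, sub_eq_add_neg]
  have h1 := hasDerivAt_bilin_apply (β := fun s => β (φ (s, x))) hβ
    (hφ.hasDerivAt_coordAt_flowDeriv hZ h v) (hφ.hasDerivAt_coordAt_flowDeriv hZ h w)
  have hev : (fun s => b (φ (s, x)) (flowDeriv φ s x v) (flowDeriv φ s x w)) =ᶠ[𝓝 t]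
      fun s => β (φ (s, x)) (coordAt p (φ (s, x)) (flowDeriv φ s x v))
        (coordAt p (φ (s, x)) (flowDeriv φ s x w)) := by
    have c2 : ContinuousAt (fun s : ℝ => (s, x)) t := by fun_prop
    filter_upwards [c2.eventually (hφ.eventually_mem h)] with s hs
    exact (congrArg₂ (fun a a' => b (φ (s, x)) a a') (constField_coordAt p hs.2 _)
      (constField_coordAt p hs.2 _)).symm
  refine (h1.congr_of_eventuallyEq hev).congr_deriv ?_
  have e : ∀ u : V, (coordAt p p : V →L[ℂ] V) u = u := coordAt_self p
  have key : ∀ a a' c c' : V, a' = a → c' = c →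
      β p (Λ a) c' + β p a' (Λ c) + (-β p (Λ a') c' - β p a' (Λ c')) = 0 := by
    rintro a a' c c' rfl rfl
    abel
  exact key _ _ _ _ (e _) (e _)

/-- A sesquilinear form with vanishing Lie derivative along `Z` is invariant under the flow of `Z`.
-/
theorem sesq_flowDeriv [FiniteDimensional ℂ V] (hφ : IsLocalFlow Z W φ)
    (hZ : SmoothOn Z Set.univ) {b : SesqField V M}
    (hb : ∀ U : Set M, IsOpen U → ∀ Y Y' : VField V M, SmoothOn Y U → SmoothOn Y' U → ∀ x ∈ U,
      MDifferentiableAt 𝓘(ℝ, V) 𝓘(ℝ, ℂ) (b.app Y Y') x ∧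
      realDer Z (b.app Y Y') x = b x (realLie Z Y x) (Y' x) + b x (Y x) (realLie Z Y' x))
    {t : ℝ} {x : M} (h : (t, x) ∈ W) (v w : TangentSpace 𝓘(ℂ, V) x) :
    b (φ (t, x)) (flowDeriv φ t x v) (flowDeriv φ t x w) = b x v w := by
  have ho : IsOpen {s : ℝ | (s, x) ∈ W} := hφ.isOpen.preimage (by fun_prop)
  have hd : ∀ s ∈ {s : ℝ | (s, x) ∈ W}, _ := fun s hs => hφ.hasDerivAt_sesq_flowDeriv hZ hb hs v w
  refine (ho.is_const_of_deriv_eq_zero (hφ.ordConnected x).isPreconnected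
    (fun s hs => (hd s hs).differentiableAt.differentiableWithinAt) (fun s hs => (hd s hs).deriv)
    h (hφ.zero_mem t x h)).trans (hφ.sesq_flowDeriv_zero b (hφ.zero_mem t x h) v w)

end IsLocalFlow

end InvariantForms

/-! ### Invariance under the flow of `i (E - Ē)` -/

section EulerFlow

variable {V : Type*} [NormedAddCommGroup V] [NormedSpace ℂ V]
  {M : Type*} [TopologicalSpace M] [ChartedSpace V M] [IsManifold 𝓘(ℂ, V) ω M]

namespace CVStructure

variable {S : CVStructure V M}

theorem mdifferentiableAt_h_app [FiniteDimensional ℂ V] (S : CVStructure V M) {U : Set M}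
    (hU : IsOpen U) {Y Z : VField V M} (hY : SmoothOn Y U) (hZ : SmoothOn Z U) {x : M}
    (hx : x ∈ U) : MDifferentiableAt 𝓘(ℝ, V) 𝓘(ℝ, ℂ) (S.h.app Y Z) x := by
  have h := smoothFunOn_bilin_app S.g_holo hU hY (S.κ_smooth U hU Z hZ)
  rw [← h_app_eq] at h
  exact (ContMDiffOn.contMDiffAt h (hU.mem_nhds hx)).mdifferentiableAt (by simp)

/-- If `D_X - L_X` is `h`-selfadjoint, then the Lie derivative of `h` along the real field
underlying `iX` vanishes: it is `h(i A ·, ·) + h(·, i A ·)` for `A = D_X - L_X`. -/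
theorem realDer_I_smul_h {X : VField V M} {A : EndoField V M}
    (hA : S.IsCovSubLie X A) (hs : ∀ x v w, S.h x (A x v) w = S.h x v (A x w)) {U : Set M}
    (hU : IsOpen U) {Y Z : VField V M} (hY : SmoothOn Y U) (hZ : SmoothOn Z U) {x : M}
    (hx : x ∈ U) :
    realDer (Complex.I • X) (S.h.app Y Z) x
      = S.h x (realLie (Complex.I • X) Y x) (Z x) + S.h x (Y x) (realLie (Complex.I • X) Z x) := by
  have h1 := sub_eq_iff_eq_add.1 (hA U hU Y hY x hx).2
  have h2 := sub_eq_iff_eq_add.1 (hA U hU Z hZ x hx).2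
  have h3 := S.chern.metric U hU (Complex.I • X) Y Z hY hZ x hx
  rw [h3]
  change S.h x (S.cov _ _ _) _ + S.h x _ (S.cov _ _ _) = _
  rw [h1, h2]
  simp only [map_add, map_smul, LinearMap.add_apply, LinearMap.smul_apply, LinearMap.map_smulₛₗ,
    Complex.conj_I, smul_eq_mul, hs]
  ring

theorem realLie_I_smul_Q {X : VField V M}
    (h : ((along realLie X).sub (alongBar realLie X)).EndoEq S.Q 0) {U : Set M} (hU : IsOpen U)
    {Y : VField V M} (hY : SmoothOn Y U) {x : M} (hx : x ∈ U) :
    realLie (Complex.I • X) (S.Q.app Y) x = S.Q x (realLie (Complex.I • X) Y x) := by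
  have e : ∀ Y : VField V M, ((along realLie X).sub (alongBar realLie X)).vf Y x
      = -(Complex.I • realLie (Complex.I • X) Y x) := fun Y => by
    change holPart realLie X Y x - antiPart realLie X Y x = _
    simp only [holPart, antiPart]
    module
  have h1 := h U hU Y hY x hx
  rw [e, e, map_neg, map_smul] at h1
  have h2 := sub_eq_zero.1 (h1.trans rfl : _ = (0 : TangentSpace 𝓘(ℂ, V) x))
  exact smul_right_injective _ Complex.I_ne_zero (neg_injective h2)

/-- `h` is constant along the flow because `L_{E-Ē}(h) = 0`, and so is `h(Q ·, ·)`. As `h` is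
nondegenerate, this determines `Q`. -/
theorem flowInvariant_I_smul [FiniteDimensional ℂ V] {X : VField V M} (hX : HolOn X Set.univ)
    {A : EndoField V M} (hA : S.IsCovSubLie X A)
    (hs : ∀ x v w, S.h x (A x v) w = S.h x v (A x w))
    (hQ : ((along realLie X).sub (alongBar realLie X)).EndoEq S.Q 0) :
    FlowInvariant (Complex.I • X) S.h S.Q := by
  intro W φ hφ t x ht
  have hZ : SmoothOn (Complex.I • X) Set.univ := (hX.const_smul Complex.I).smoothOn isOpen_univ
  have hh : ∀ v w, S.h (φ (t, x)) (flowDeriv φ t x v) (flowDeriv φ t x w) = S.h x v w :=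
    hφ.sesq_flowDeriv hZ (fun U hU Y Z hY hZ y hy =>
      ⟨S.mdifferentiableAt_h_app hU hY hZ hy, realDer_I_smul_h hA hs hU hY hZ hy⟩) ht
  have hhQ : ∀ v w, S.h (φ (t, x)) (S.Q (φ (t, x)) (flowDeriv φ t x v)) (flowDeriv φ t x w)
      = S.h x (S.Q x v) w :=
    hφ.sesq_flowDeriv (b := fun y => (S.h y).comp (S.Q y)) hZ (fun U hU Y Z hY hZ y hy => by
      have hQY := S.Q_smooth U hU Y hY
      refine ⟨S.mdifferentiableAt_h_app hU hQY hZ hy,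
        (realDer_I_smul_h hA hs hU hQY hZ hy).trans ?_⟩
      rw [realLie_I_smul_Q hQ hU hY hy]
      rfl) ht
  refine fun v w => ⟨hh v w, ?_⟩
  -- `dφ_t` is injective as it preserves `h`, hence bijective for dimension reasons. So the identity
  -- `h(dφ 𝒬 v, dφ u) = h(𝒬 dφ v, dφ u)` for all `u` suffices.
  let F : V →L[ℝ] V := mfderiv 𝓘(ℝ, V) 𝓘(ℝ, V) (fun y => φ (t, y)) x
  have hinj : Function.Injective F := (injective_iff_map_eq_zero F).2 fun u hu => by
    refine (S.h_nondeg x).1 u fun w => ?_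
    have hu' : flowDeriv φ t x u = 0 := hu
    rw [← hh u w, hu', map_zero, LinearMap.zero_apply]
  have hsurj : Function.Surjective F :=
    F.toLinearMap.surjective_of_injective hinj
  refine sub_eq_zero.1 ((S.h_nondeg _).1 _ fun u => ?_)
  obtain ⟨u, rfl⟩ := hsurj u
  have h1 := (hh (S.Q x v) u).trans (hhQ v u).symm
  rw [map_sub]
  exact sub_eq_zero.2 h1

end CVStructure

end EulerFlow

end CVGeom

open CVGeom in
theorem mainTheorem2 {V : Type*} [NormedAddCommGroup V] [NormedSpace ℂ V] [FiniteDimensional ℂ V]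
    {M : Type*} [TopologicalSpace M] [ChartedSpace V M] [IsManifold 𝓘(ℂ, V) ω M]
    (S : CVStructure V M) (hunf : S.Unfolding)
    (hsymm : ∀ (x : M) (X Y : TangentSpace 𝓘(ℂ, V) x), S.C x X Y = S.C x Y X) :
    (∃! p : VField V M × VField V M, S.IsUnitEuler p.1 p.2) ∧
    ∀ e Eu : VField V M, S.IsUnitEuler e Eu →
      -- the induced F-manifold
      IsFManifold S.mul e Eu ∧
      -- the formula for `𝒬` and its invariance along the unit field
      (IsSkewPartOfDiff S.g S.cov realLie Eu S.Q ∧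
        (alongBar realLie e).EndoEq S.Q 0 ∧
        (alongBar S.cov e).EndoEq S.Q 0 ∧
        (along S.cov e).EndoEq S.Q 0) ∧
      -- the equivalent conditions on the unit field
      (List.TFAE
          [AgreeOnTensors S.cov realLie e,
           AgreeOnFields S.cov realLie e,
           ∀ x : M, holPart S.cov e e x = 0,
           (along realLie e).SesqZero S.h,
           (alongBar realLie e).SesqZero S.h,
           (along realLie e).ConjZero S.κ,
           (alongBar realLie e).ConjZero S.κ,
           (along realLie e).BilinEq S.g 0] ∧
        (AgreeOnTensors S.cov realLie e → (along realLie e).EndoEq S.Q 0)) ∧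
      -- consequences of `L_E g = (2 - d) g`
      (∀ d : ℝ, (along realLie Eu).BilinEq S.g (2 - d) →
        (∀ U : Set M, IsOpen U → ∀ Y : VField V M, SmoothOn Y U → ∀ x ∈ U,
          S.Q x (Y x)
            = holPart S.cov Eu Y x - holPart realLie Eu Y x - ((2 - d) / 2 : ℂ) • Y x) ∧
        ((along realLie Eu).sub (alongBar realLie Eu)).SesqZero S.h ∧
        (along realLie Eu).EndoEq S.Q (comm S.U (conjBy S.κ S.U)) ∧
        (alongBar realLie Eu).EndoEq S.Q (comm S.U (conjBy S.κ S.U)) ∧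
        (along S.cov Eu).EndoEq S.Q (comm S.U (conjBy S.κ S.U)) ∧
        (alongBar S.cov Eu).EndoEq S.Q (comm S.U (conjBy S.κ S.U)) ∧
        ((along realLie Eu).sub (alongBar realLie Eu)).EndoEq S.Q 0 ∧
        -- the real field `i (E - Ē)` corresponds to the `(1,0)`-field `i E`
        FlowInvariant (Complex.I • Eu) S.h S.Q) := by
  have := FiniteDimensional.complete ℂ V
  refine ⟨CVStructure.existsUnique_isUnitEuler hunf hsymm, fun e Eu hE => ?_⟩
  refine ⟨CVStructure.isFManifold hsymm hE,
    ⟨CVStructure.isSkewPartOfDiff_Q hsymm hE,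
      CVStructure.alongBar_realLie_endoEq hE.1 (CVStructure.alongBar_cov_unit_Q hE),
      CVStructure.alongBar_cov_unit_Q hE, CVStructure.along_cov_unit_Q hE⟩,
    ⟨CVStructure.tfae_unit hsymm hE, CVStructure.along_realLie_unit_Q hE⟩, fun d hd => ?_⟩
  obtain ⟨A, hA⟩ := S.exists_isCovSubLie hE.2.1
  have hAQ := hA.euler_eq hsymm hE hd
  have hs := CVStructure.h_euler_symm hAQ
  have h1 := CVStructure.along_realLie_euler_Q hE hA hAQ
  have h2 := CVStructure.alongBar_realLie_endoEq hE.2.1 (CVStructure.alongBar_cov_euler_Q hE)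
  have h3 := CVStructure.sub_endoEq_zero h1 h2
  refine ⟨fun U hU Y hY x hx => ?_, CVStructure.sesqZero_euler_sub hA hs, h1, h2,
    CVStructure.along_cov_euler_Q hE, CVStructure.alongBar_cov_euler_Q hE, h3,
    CVStructure.flowInvariant_I_smul hE.2.1 hA hs h3⟩
  rw [hA.holPart_eq hU hY hx, hAQ]
  abel
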